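/- Let $Q$ be a commutative ring and let $k \geq 1$ be an integer such that $k!$ is invertible in $Q$. For a chain complex $M$ of $Q$-modules concentrated in non-negative degrees, let $T^k_Q(M) = M \otimes_Q \cdots \otimes_Q M$ ($k$ factors) be its $k$-th tensor power, with differential $$d(x_1 \otimes \cdots \otimes x_k) = \sum_{i} (-1)^{|x_1| + \cdots + |x_{i-1}|}\, x_1 \otimes \cdots \otimes d x_i \otimes \cdots \otimes x_k ,$$ and let the symmetric group $\Sigma_k$ act on it by permuting tensor factors with the Koszul sign (the adjacent transposition $(i\ i{+}1)$ exchanges $x_i$ and $x_{i+1}$ and multiplies by $(-1)^{|x_i||x_{i+1}|}$). For a $Q$-module $Y$ (or complex of $Q$-modules) with a $\Sigma_k$-action put $$Y^{(\mathrm{sign})} = \mathrm{Hom}_{Q[\Sigma_k]}(Q_{\mathrm{sign}}, Y) = \{ y \in Y : \sigma y = \mathrm{sign}(\sigma)\, y \text{ for all } \sigma \in \Sigma_k \},$$ where $Q_{\mathrm{sign}}$ is $Q$ with $\sigma \cdot q = \mathrm{sign}(\sigma) q$, and set $\Lambda^k_Q(M) = T^k_Q(M)^{(\mathrm{sign})}$,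 a subcomplex of $T^k_Q(M)$. For a simplicial $Q$-module $A$, let $\Lambda^k_Q(A)$ be the simplicial $Q$-module obtained by applying, in each simplicial degree, the functor $V \mapsto (V^{\otimes k})^{(\mathrm{sign})}$, where $\Sigma_k$ acts on $V^{\otimes k}$ by permuting the factors, without signs. Let $K$ be the Dold–Puppe functor from chain complexes of $Q$-modules concentrated in non-negative degrees to simplicial $Q$-modules, and let $N$ be the normalized chain complex functor, $N(A)_n = \bigcap_{i=1}^n \ker(d_i \colon A_n \to A_{n-1})$ with differential $d_0$. Then there is a chain map $$\Lambda^k_Q(M) \longrightarrow N\bigl(\Lambda^k_Q(K(M))\bigr),$$ defined for every chain complex $M$ of $Q$-modules concentrated in non-negative degrees and natural in $M$, which is a quasi-isomorphism for every such $M$. -/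

import Mathlib

open CategoryTheory DirectSum TensorProduct

universe u

noncomputable section

namespace NaiveExteriorPower

/-! ### The sign-isotypic part of a representation of the symmetric group -/

/-- The sign representation `Q_sign` of the symmetric group: `σ • q = sign(σ) q`. -/
def signRep (Q : Type u) [CommRing Q] (k : ℕ) : Representation Q (Equiv.Perm (Fin k)) Q where
  toFun σ := (((Equiv.Perm.sign σ : ℤˣ) : ℤ) : Q) • LinearMap.id
  map_one' := by simp; rfl
  map_mul' σ τ := by
    ext
    simp [mul_comm]

/-- The sign-isotypic part `V^(sign)` of a `Q[Σ_k]`-module `V`, realized as the submodule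
of all `y` such that `σ y = sign(σ) y` for all `σ`. -/
def signPart {Q : Type u} [CommRing Q] {k : ℕ} {V : Type u} [AddCommGroup V] [Module Q V]
    (ρ : Representation Q (Equiv.Perm (Fin k)) V) : Submodule Q V where
  carrier := {y | ∀ σ : Equiv.Perm (Fin k), ρ σ y = (((Equiv.Perm.sign σ : ℤˣ) : ℤ) : Q) • y}
  add_mem' hx hy σ := by rw [map_add, hx σ, hy σ, smul_add]
  zero_mem' σ := by simp
  smul_mem' c x hx σ := by rw [map_smul, hx σ, smul_comm]

/-- `V^(sign)` is `Hom_{Q[Σ_k]}(Q_sign, V)`, through evaluation at `1`. -/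
def homSignEquiv {Q : Type u} [CommRing Q] {k : ℕ} {V : Type u} [AddCommGroup V] [Module Q V]
    (ρ : Representation Q (Equiv.Perm (Fin k)) V) :
    Representation.IntertwiningMap (signRep Q k) ρ ≃ₗ[Q] signPart ρ where
  toFun f := ⟨f 1, fun σ => by
    have h : f.toLinearMap ((((Equiv.Perm.sign σ : ℤˣ) : ℤ) : Q) • (1 : Q)) = ρ σ (f.toLinearMap 1) :=
      LinearMap.congr_fun (f.isIntertwining' σ) 1
    rw [map_smul] at h
    exact h.symm⟩
  map_add' f g := by ext; rfl
  map_smul' c f := by ext; rfl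
  invFun y :=
    { toLinearMap := LinearMap.toSpanSingleton Q V y
      isIntertwining' := fun σ => by
        ext
        change ((((Equiv.Perm.sign σ : ℤˣ) : ℤ) : Q) • (1 : Q)) • (y : V) = ρ σ ((1 : Q) • (y : V))
        rw [one_smul, y.2 σ, smul_assoc, one_smul] }
  left_inv f := by
    ext
    simp
  right_inv y := by
    ext
    simp

/-! ### Exterior powers of modules, as modules of antisymmetric tensors -/

/-- The (unsigned) action of `Σ_k` on the `k`-th tensor power of a module, by permutation
of the tensor factors. -/
def permRep (Q : Type u) [CommRing Q] (k : ℕ) (V : Type u) [AddCommGroup V] [Module Q V] :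
    Representation Q (Equiv.Perm (Fin k)) (⨂[Q] (_ : Fin k), V) where
  toFun σ := (PiTensorProduct.reindex Q (fun _ => V) σ).toLinearMap
  map_one' := by
    refine PiTensorProduct.ext (MultilinearMap.ext fun x => ?_)
    exact PiTensorProduct.reindex_tprod (R := Q) (s := fun _ => V) (1 : Equiv.Perm (Fin k)) x
  map_mul' σ τ := by
    refine PiTensorProduct.ext (MultilinearMap.ext fun x => ?_)
    simp only [LinearMap.compMultilinearMap_apply, Module.End.mul_apply, LinearEquiv.coe_coe]
    rw [PiTensorProduct.reindex_tprod, PiTensorProduct.reindex_tprod,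
      PiTensorProduct.reindex_tprod]
    rfl

/-- `Λ^k_Q` on modules: the functor `V ↦ T^k(V)^(sign)`. -/
def extPowerModule (Q : Type u) [CommRing Q] (k : ℕ) : ModuleCat.{u} Q ⥤ ModuleCat.{u} Q where
  obj V := ModuleCat.of Q (signPart (permRep Q k V))
  map {V W} f := ModuleCat.ofHom
    ((PiTensorProduct.map (fun _ : Fin k => f.hom)).restrict (fun y hy σ => by
      have h := PiTensorProduct.map_reindex (R := Q) (fun _ : Fin k => f.hom) σ y
      have h' := hy σ
      simp only [permRep, MonoidHom.coe_mk, OneHom.coe_mk, LinearEquiv.coe_coe] at h' ⊢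
      rw [← h, h', map_smul]))
  map_id V := by
    refine ModuleCat.hom_ext (LinearMap.ext fun y => Subtype.ext ?_)
    exact LinearMap.congr_fun (PiTensorProduct.map_id (R := Q)) (y : ⨂[Q] (_ : Fin k), V)
  map_comp f g := by
    refine ModuleCat.hom_ext (LinearMap.ext fun y => Subtype.ext ?_)
    exact LinearMap.congr_fun (PiTensorProduct.map_comp (R := Q) (fun _ => g.hom)
      (fun _ => f.hom)) (y : ⨂[Q] (_ : Fin k), _)

/-- `Λ^k_Q` on simplicial modules: `extPowerModule` applied degreewise. -/
def extPowerSimplicial (Q : Type u) [CommRing Q] (k : ℕ) :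
    SimplicialObject (ModuleCat.{u} Q) ⥤ SimplicialObject (ModuleCat.{u} Q) :=
  (SimplicialObject.whiskering _ _).obj (extPowerModule Q k)

/-! ### Koszul signs -/

/-- The Koszul sign of `σ` acting on a tensor of homogeneous elements of degrees
`a 0, ..., a (k - 1)`: the product of `(-1) ^ (a i * a j)` over all inversions of `σ`. For
an adjacent transposition of the positions `i, i + 1` it is `(-1) ^ (a i * a (i + 1))`. -/
def koszulSign {k : ℕ} (σ : Equiv.Perm (Fin k)) (a : Fin k → ℕ) : ℤ :=
  ∏ i, ∏ j, if i < j ∧ σ j < σ i then (-1) ^ (a i * a j) else 1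

theorem koszulSign_one {k : ℕ} (a : Fin k → ℕ) : koszulSign 1 a = 1 := by
  unfold koszulSign
  refine Finset.prod_eq_one fun i _ => Finset.prod_eq_one fun j _ => if_neg ?_
  rintro ⟨h, h'⟩
  exact lt_asymm h h'

theorem prod_pairs_comp {k : ℕ} (τ : Equiv.Perm (Fin k)) (f : Fin k → Fin k → ℤ)
    (hf : ∀ i j, f i j = f j i) :
    (∏ i, ∏ j, if i < j then f (τ i) (τ j) else 1) = ∏ i, ∏ j, if i < j then f i j else 1 := by
  let s : Fin k → Fin k → ℤ := fun i j => if i < j then 1 else if j < i then -1 else 0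
  have hs : ∀ i j, s i j = - s j i := by
    intro i j
    simp only [s]
    split_ifs <;> first | rfl | omega
  have hsf : ∀ i j, s i j * f i j = -(s j i * f j i) := by
    intro i j
    rw [hs i j, hf i j, neg_mul]
  have h1 := τ.prod_Ioi_comp_eq_sign_mul_prod hs
  have h2 := τ.prod_Ioi_comp_eq_sign_mul_prod hsf
  have h3 : (∏ i : Fin k, ∏ j ∈ Finset.Ioi i, s i j) = 1 :=
    Finset.prod_eq_one fun i _ => Finset.prod_eq_one fun j hj => by
      simp [s, Finset.mem_Ioi.1 hj]
  simp only [Finset.prod_mul_distrib] at h2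
  rw [h1, h3] at h2
  simp only [mul_one, one_mul] at h2
  have h4 := mul_left_cancel₀ (Units.ne_zero _) h2
  simpa [← Finset.prod_filter, Finset.filter_lt_eq_Ioi] using h4

theorem koszulSign_mul {k : ℕ} (σ τ : Equiv.Perm (Fin k)) (a : Fin k → ℕ) :
    koszulSign (σ * τ) a = koszulSign τ a * koszulSign σ (fun i => a (τ.symm i)) := by
  have h := prod_pairs_comp τ (fun p q => if (p < q ∧ σ q < σ p) ∨ (q < p ∧ σ p < σ q) then
    (-1) ^ (a (τ.symm p) * a (τ.symm q)) else 1) (by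
      intro i j
      rw [mul_comm]
      congr 1
      exact propext or_comm)
  have h' : koszulSign σ (fun i => a (τ.symm i)) =
      ∏ i, ∏ j, if i < j then (if (i < j ∧ σ j < σ i) ∨ (j < i ∧ σ i < σ j) then
        (-1) ^ (a (τ.symm i) * a (τ.symm j)) else 1) else 1 := by
    unfold koszulSign
    refine Finset.prod_congr rfl fun i _ => Finset.prod_congr rfl fun j _ => ?_
    by_cases hij : i < j
    · simp [hij, hij.asymm]
    · simp [hij]
  rw [h', ← h]
  unfold koszulSign
  simp only [← Finset.prod_mul_distrib]
  refine Finset.prod_congr rfl fun i _ => Finset.prod_congr rfl fun j _ => ?_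
  by_cases hij : i < j
  · have hne : τ i ≠ τ j := fun e => hij.ne (τ.injective e)
    have hne' : σ (τ i) ≠ σ (τ j) := fun e => hne (σ.injective e)
    have hsq : ((-1 : ℤ) ^ (a i * a j)) * (-1) ^ (a i * a j) = 1 := by
      rw [← mul_pow]; simp
    rcases lt_or_gt_of_ne hne with h1 | h1 <;> rcases lt_or_gt_of_ne hne' with h2 | h2 <;>
      simp [hij, h1, h2, h1.asymm, h2.asymm, hsq]
  · simp [hij]

theorem koszulSign_update {k : ℕ} (σ : Equiv.Perm (Fin k)) (a : Fin k → ℕ) (i : Fin k)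
    (hi : a i ≠ 0) :
    (∏ l, if l < i then (-1 : ℤ) ^ a l else 1) * koszulSign σ (Function.update a i (a i - 1)) =
      koszulSign σ a * ∏ l, if σ l < σ i then (-1 : ℤ) ^ a l else 1 := by
  have key : koszulSign σ (Function.update a i (a i - 1)) = koszulSign σ a *
      ((∏ p, if p < i ∧ σ i < σ p then (-1 : ℤ) ^ a p else 1) *
        ∏ q, if i < q ∧ σ q < σ i then (-1 : ℤ) ^ a q else 1) := by
    have e1 : (∏ p, if p < i ∧ σ i < σ p then (-1 : ℤ) ^ a p else 1) =
        ∏ p, ∏ q, if q = i then (if p < q ∧ σ q < σ p then (-1 : ℤ) ^ a p else 1) else 1 := by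
      simp
    have e2 : (∏ q, if i < q ∧ σ q < σ i then (-1 : ℤ) ^ a q else 1) =
        ∏ p, ∏ q, if p = i then (if p < q ∧ σ q < σ p then (-1 : ℤ) ^ a q else 1) else 1 := by
      rw [Finset.prod_comm]
      simp
    rw [e1, e2]
    unfold koszulSign
    simp only [← Finset.prod_mul_distrib]
    refine Finset.prod_congr rfl fun p _ => Finset.prod_congr rfl fun q _ => ?_
    by_cases hpq : p < q ∧ σ q < σ p
    · obtain ⟨c, hc⟩ := Nat.exists_eq_succ_of_ne_zero hi
      have sq : ∀ n : ℕ, (-1 : ℤ) ^ n * (-1) ^ n = 1 := fun n => by rw [← mul_pow]; simp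
      simp only [if_pos hpq]
      by_cases hp : p = i
      · subst hp
        have hq : q ≠ p := hpq.1.ne'
        simp only [Function.update_self, Function.update_of_ne hq, hc, if_neg hq, if_true,
          Nat.succ_eq_add_one, Nat.add_sub_cancel, one_mul, add_mul, pow_add, mul_assoc, sq,
          mul_one]
      · by_cases hq : q = i
        · subst hq
          simp only [Function.update_self, Function.update_of_ne hp, hc, if_neg hp, if_true,
            Nat.succ_eq_add_one, Nat.add_sub_cancel, mul_add, pow_add, mul_assoc, sq,
            mul_one]
        · simp [hp, hq]
    · simp [hpq]
  rw [key, mul_left_comm]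
  congr 1
  simp only [← Finset.prod_mul_distrib]
  refine Finset.prod_congr rfl fun l _ => ?_
  have sq : ∀ n : ℕ, (-1 : ℤ) ^ n * (-1) ^ n = 1 := fun n => by rw [← mul_pow]; simp
  rcases lt_trichotomy l i with h | h | h
  · have hne : σ l ≠ σ i := fun e => h.ne (σ.injective e)
    rcases lt_or_gt_of_ne hne with h2 | h2 <;> simp [h, h2, h.asymm, h2.asymm, sq]
  · subst h; simp
  · have hne : σ l ≠ σ i := fun e => h.ne' (σ.injective e)
    rcases lt_or_gt_of_ne hne with h2 | h2 <;> simp [h, h2, h.asymm, h2.asymm]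

/-! ### Tensor powers of complexes

The tensor power `T^k(M)` is realized as the `k`-th tensor power of the total module `⨁ n, M_n`,
graded by total degree. -/

section Complex

variable {Q : Type u} [CommRing Q]

/-- The total module `⨁ n, M_n` of a complex. -/
abbrev Tot (M : ChainComplex (ModuleCat.{u} Q) ℕ) : Type u := ⨁ n : ℕ, M.X n

/-- The differential of `M` on the total module (recall that `M.d 0 0 = 0`). -/
def totD (M : ChainComplex (ModuleCat.{u} Q) ℕ) : Tot M →ₗ[Q] Tot M :=
  DirectSum.toModule Q ℕ (Tot M) fun n =>
    (DirectSum.lof Q ℕ (fun m => M.X m) (n - 1)) ∘ₗ (M.d n (n - 1)).hom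

/-- The operator that multiplies the elements of degree `n` by `(-1) ^ n`. -/
def totSign (M : ChainComplex (ModuleCat.{u} Q) ℕ) : Tot M →ₗ[Q] Tot M :=
  DirectSum.toModule Q ℕ (Tot M) fun n =>
    ((-1 : Q) ^ n) • (DirectSum.lof Q ℕ (fun m => M.X m) n)

/-- The map of total modules induced by a chain map. -/
def totMap {M N : ChainComplex (ModuleCat.{u} Q) ℕ} (f : M ⟶ N) : Tot M →ₗ[Q] Tot N :=
  DirectSum.toModule Q ℕ (Tot N) fun n =>
    (DirectSum.lof Q ℕ (fun m => N.X m) n) ∘ₗ (f.f n).hom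

/-- The underlying module of `T^k(M)`, all degrees together. -/
abbrev TPow (k : ℕ) (M : ChainComplex (ModuleCat.{u} Q) ℕ) : Type u := ⨂[Q] (_ : Fin k), Tot M

/-- The tensor `x 0 ⊗ ... ⊗ x (k - 1)` of homogeneous elements `x i` of degrees `a i`. -/
def homTensor {k : ℕ} (M : ChainComplex (ModuleCat.{u} Q) ℕ) (a : Fin k → ℕ)
    (x : ∀ i, M.X (a i)) : TPow k M :=
  PiTensorProduct.tprod Q fun i => DirectSum.lof Q ℕ (fun m => M.X m) (a i) (x i)

/-- The part of `T^k(M)` of degree `n`, spanned by the tensors of homogeneous elements of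
total degree `n`. -/
def tPowDeg (k : ℕ) (M : ChainComplex (ModuleCat.{u} Q) ℕ) (n : ℕ) : Submodule Q (TPow k M) :=
  Submodule.span Q {y | ∃ a : Fin k → ℕ, ∑ i, a i = n ∧ ∃ x : ∀ i, M.X (a i), y = homTensor M a x}

/-- The differential of `T^k(M)`, i.e. the sum over `i` of
`x_1 ⊗ ... ⊗ x_k ↦ (-1)^(|x_1| + ... + |x_(i-1)|) x_1 ⊗ ... ⊗ d x_i ⊗ ... ⊗ x_k`. -/
def tPowD (k : ℕ) (M : ChainComplex (ModuleCat.{u} Q) ℕ) : TPow k M →ₗ[Q] TPow k M :=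
  ∑ i : Fin k, PiTensorProduct.map fun j =>
    if j < i then totSign M else if j = i then totD M else LinearMap.id

/-- The map `T^k(M) → T^k(N)` induced by a chain map. -/
def tPowMap (k : ℕ) {M N : ChainComplex (ModuleCat.{u} Q) ℕ} (f : M ⟶ N) :
    TPow k M →ₗ[Q] TPow k N :=
  PiTensorProduct.map fun _ => totMap f

/-- The signed action of a permutation on `T^k(M)`: a tensor `x_1 ⊗ ... ⊗ x_k` of homogeneous
elements is permuted and multiplied by the Koszul sign. The tensor power of the total module is
decomposed here as the direct sum of the `M_(a 0) ⊗ ... ⊗ M_(a (k - 1))` over all `a`. -/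
def tPowAct (k : ℕ) (M : ChainComplex (ModuleCat.{u} Q) ℕ) (σ : Equiv.Perm (Fin k)) :
    TPow k M →ₗ[Q] TPow k M :=
  (PiTensorProduct.ofDirectSumEquiv (R := Q) (M := fun (_ : Fin k) n => M.X n)).symm.toLinearMap ∘ₗ
    (DirectSum.toModule Q (Fin k → ℕ) (⨁ a : Fin k → ℕ, ⨂[Q] i, M.X (a i)) fun a =>
      (koszulSign σ a : Q) •
        ((DirectSum.lof Q (Fin k → ℕ) (fun b => ⨂[Q] i, M.X (b i)) (fun i => a (σ.symm i))) ∘ₗ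
          (PiTensorProduct.reindex Q (fun i => M.X (a i)) σ).toLinearMap)) ∘ₗ
    (PiTensorProduct.ofDirectSumEquiv (R := Q) (M := fun (_ : Fin k) n => M.X n)).toLinearMap

theorem tPow_ext {k : ℕ} {M : ChainComplex (ModuleCat.{u} Q) ℕ} {E : Type u} [AddCommGroup E]
    [Module Q E] {f g : TPow k M →ₗ[Q] E}
    (h : ∀ (a : Fin k → ℕ) (x : ∀ i, M.X (a i)), f (homTensor M a x) = g (homTensor M a x)) :
    f = g := by
  have e : f ∘ₗ (PiTensorProduct.ofDirectSumEquiv (R := Q)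
      (M := fun (_ : Fin k) n => M.X n)).symm.toLinearMap = g ∘ₗ (PiTensorProduct.ofDirectSumEquiv
      (R := Q) (M := fun (_ : Fin k) n => M.X n)).symm.toLinearMap := by
    refine DirectSum.linearMap_ext Q fun a => ?_
    refine PiTensorProduct.ext (MultilinearMap.ext fun x => ?_)
    have := h a x
    simpa [homTensor] using this
  ext1
  refine MultilinearMap.ext fun x => ?_
  have := LinearMap.congr_fun e (PiTensorProduct.ofDirectSumEquiv (PiTensorProduct.tprod Q x))
  simpa using this

theorem tPowAct_homTensor {k : ℕ} (M : ChainComplex (ModuleCat.{u} Q) ℕ)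
    (σ : Equiv.Perm (Fin k)) (a : Fin k → ℕ) (x : ∀ i, M.X (a i)) :
    tPowAct k M σ (homTensor M a x) =
      (koszulSign σ a : Q) • homTensor M (fun i => a (σ.symm i)) (fun i => x (σ.symm i)) := by
  simp only [tPowAct, homTensor, LinearMap.comp_apply, LinearEquiv.coe_coe,
    PiTensorProduct.ofDirectSumEquiv_tprod_lof, DirectSum.toModule_lof, LinearMap.smul_apply,
    PiTensorProduct.reindex_tprod, map_smul]
  congr 1
  exact PiTensorProduct.ofDirectSumEquiv_symm_lof_tprod (R := Q)
    (M := fun (_ : Fin k) n => M.X n) (fun i => a (σ.symm i)) (fun i => x (σ.symm i))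

/-- The signed action of `Σ_k` on `T^k(M)`. -/
def tPowRep (k : ℕ) (M : ChainComplex (ModuleCat.{u} Q) ℕ) :
    Representation Q (Equiv.Perm (Fin k)) (TPow k M) where
  toFun σ := tPowAct k M σ
  map_one' := tPow_ext fun a x => by
    rw [tPowAct_homTensor, koszulSign_one, Int.cast_one, one_smul]
    rfl
  map_mul' σ τ := tPow_ext fun a x => by
    rw [Module.End.mul_apply, tPowAct_homTensor M (σ * τ), tPowAct_homTensor M τ, map_smul,
      tPowAct_homTensor M σ, koszulSign_mul, Int.cast_mul, mul_smul]
    rfl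

theorem tPowMap_homTensor {k : ℕ} {M N : ChainComplex (ModuleCat.{u} Q) ℕ} (f : M ⟶ N)
    (a : Fin k → ℕ) (x : ∀ i, M.X (a i)) :
    tPowMap k f (homTensor M a x) = homTensor N a (fun i => (f.f (a i)).hom (x i)) := by
  simp [tPowMap, homTensor, totMap]

theorem tPowAct_tprod {k : ℕ} (M : ChainComplex (ModuleCat.{u} Q) ℕ)
    (σ : Equiv.Perm (Fin k)) (a : Fin k → ℕ) (z : Fin k → Tot M)
    (hz : ∀ i, ∃ x : M.X (a i), z i = DirectSum.lof Q ℕ (fun m => M.X m) (a i) x) :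
    tPowAct k M σ (PiTensorProduct.tprod Q z) =
      (koszulSign σ a : Q) • PiTensorProduct.tprod Q fun i => z (σ.symm i) := by
  choose x hx using hz
  obtain rfl : z = fun i => DirectSum.lof Q ℕ (fun m => M.X m) (a i) (x i) := funext hx
  exact tPowAct_homTensor M σ a x

theorem tPowD_homTensor {k : ℕ} (M : ChainComplex (ModuleCat.{u} Q) ℕ)
    (a : Fin k → ℕ) (x : ∀ i, M.X (a i)) :
    tPowD k M (homTensor M a x) = ∑ i, (∏ l, if l < i then (-1 : Q) ^ a l else 1) •
      PiTensorProduct.tprod Q (Function.update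
        (fun j => DirectSum.lof Q ℕ (fun m => M.X m) (a j) (x j)) i
        (DirectSum.lof Q ℕ (fun m => M.X m) (a i - 1) ((M.d (a i) (a i - 1)).hom (x i)))) := by
  simp only [tPowD, LinearMap.sum_apply, homTensor, PiTensorProduct.map_tprod]
  refine Finset.sum_congr rfl fun i _ => ?_
  rw [← MultilinearMap.map_smul_univ]
  congr 1
  funext l
  by_cases h : l < i
  · simp only [if_pos h, Function.update_of_ne h.ne, totSign, DirectSum.toModule_lof,
      LinearMap.smul_apply]
  · by_cases h' : l = i
    · subst h'
      simp [totD]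
    · simp [h, h']

theorem tPowD_update_mem {k : ℕ} (M : ChainComplex (ModuleCat.{u} Q) ℕ)
    (a : Fin k → ℕ) (x : ∀ i, M.X (a i)) (i : Fin k) (y : M.X (a i - 1)) (j : Fin k) :
    ∃ w : M.X (Function.update a i (a i - 1) j),
      Function.update (fun j => DirectSum.lof Q ℕ (fun m => M.X m) (a j) (x j)) i
        (DirectSum.lof Q ℕ (fun m => M.X m) (a i - 1) y) j =
      DirectSum.lof Q ℕ (fun m => M.X m) (Function.update a i (a i - 1) j) w := by
  have key : ∀ (m n : ℕ) (_ : n = m) (v : M.X m), ∃ w : M.X n,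
      DirectSum.lof Q ℕ (fun m => M.X m) m v = DirectSum.lof Q ℕ (fun m => M.X m) n w := by
    rintro m _ rfl v
    exact ⟨v, rfl⟩
  by_cases h : j = i
  · subst h
    rw [Function.update_self (f := fun j => DirectSum.lof Q ℕ (fun m => M.X m) (a j) (x j))]
    exact key _ _ (Function.update_self _ _ _) y
  · rw [Function.update_of_ne h (f := fun j => DirectSum.lof Q ℕ (fun m => M.X m) (a j) (x j))]
    exact key _ _ (Function.update_of_ne h _ _) (x j)

/-- The signed action of `Σ_k` on `T^k(M)` is by chain maps. -/
theorem tPowAct_comp_tPowD {k : ℕ} (M : ChainComplex (ModuleCat.{u} Q) ℕ)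
    (σ : Equiv.Perm (Fin k)) : tPowAct k M σ ∘ₗ tPowD k M = tPowD k M ∘ₗ tPowAct k M σ := by
  refine tPow_ext fun a x => ?_
  rw [LinearMap.comp_apply, LinearMap.comp_apply, tPowAct_homTensor, map_smul, tPowD_homTensor,
    tPowD_homTensor, map_sum, Finset.smul_sum]
  refine Eq.trans ?_ (Equiv.sum_comp σ _)
  refine Finset.sum_congr rfl fun i _ => ?_
  rw [map_smul, tPowAct_tprod M σ (Function.update a i (a i - 1)) _
    (tPowD_update_mem M a x i _), smul_smul, smul_smul]
  have hz : (fun j => Function.update (fun j => DirectSum.lof Q ℕ (fun m => M.X m) (a j) (x j)) i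
        (DirectSum.lof Q ℕ (fun m => M.X m) (a i - 1) ((M.d (a i) (a i - 1)).hom (x i)))
        (σ.symm j)) =
      Function.update (fun j => DirectSum.lof Q ℕ (fun m => M.X m) (a (σ.symm j)) (x (σ.symm j)))
        (σ i) (DirectSum.lof Q ℕ (fun m => M.X m) (a (σ.symm (σ i)) - 1)
          ((M.d (a (σ.symm (σ i))) (a (σ.symm (σ i)) - 1)).hom (x (σ.symm (σ i))))) := by
    funext j
    obtain ⟨l, rfl⟩ := σ.surjective j
    by_cases h : l = i
    · subst h
      rw [Function.update_self, σ.symm_apply_apply, Function.update_self]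
    · rw [Function.update_of_ne (fun e => h (σ.injective e)), σ.symm_apply_apply,
        Function.update_of_ne h]
  rw [← hz]
  by_cases hi : a i = 0
  · have h0 : (PiTensorProduct.tprod Q fun j => Function.update
        (fun j => DirectSum.lof Q ℕ (fun m => M.X m) (a j) (x j)) i
        (DirectSum.lof Q ℕ (fun m => M.X m) (a i - 1) ((M.d (a i) (a i - 1)).hom (x i)))
        (σ.symm j)) = 0 := by
      refine MultilinearMap.map_coord_zero _ (σ i) ?_
      rw [σ.symm_apply_apply, Function.update_self, M.shape _ _ (by simp [hi])]
      simp
    rw [h0, smul_zero, smul_zero]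
  · congr 1
    have h := congrArg (Int.cast : ℤ → Q) (koszulSign_update σ a i hi)
    push_cast at h
    rw [h]
    congr 1
    rw [← Equiv.prod_comp σ (fun l => if l < σ i then (-1 : Q) ^ a (σ.symm l) else 1)]
    simp

theorem tPowD_mem {k : ℕ} (M : ChainComplex (ModuleCat.{u} Q) ℕ) {n : ℕ} {y : TPow k M}
    (hy : y ∈ tPowDeg k M (n + 1)) : tPowD k M y ∈ tPowDeg k M n := by
  refine (Submodule.span_le (p := (tPowDeg k M n).comap (tPowD k M))).2 ?_ hy
  rintro _ ⟨a, ha, x, rfl⟩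
  rw [SetLike.mem_coe, Submodule.mem_comap, tPowD_homTensor]
  refine Submodule.sum_mem _ fun i _ => Submodule.smul_mem _ _ ?_
  by_cases hi : a i = 0
  · rw [MultilinearMap.map_coord_zero _ i]
    · exact Submodule.zero_mem _
    · rw [Function.update_self, M.shape _ _ (by simp [hi])]
      simp
  · choose w hw using tPowD_update_mem M a x i ((M.d (a i) (a i - 1)).hom (x i))
    refine Submodule.subset_span ⟨Function.update a i (a i - 1), ?_, w, ?_⟩
    · rw [Finset.sum_update_of_mem (Finset.mem_univ i)]
      rw [← Finset.add_sum_erase _ _ (Finset.mem_univ i)] at ha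
      rw [Finset.sdiff_singleton_eq_erase]
      omega
    · exact congrArg (PiTensorProduct.tprod Q) (funext hw)

theorem totD_comp_totD (M : ChainComplex (ModuleCat.{u} Q) ℕ) : totD M ∘ₗ totD M = 0 := by
  refine DirectSum.linearMap_ext Q fun n => LinearMap.ext fun x => ?_
  have h : (M.d (n - 1) (n - 1 - 1)).hom ((M.d n (n - 1)).hom x) = 0 := by
    rw [← LinearMap.comp_apply, ← ModuleCat.hom_comp, M.d_comp_d]
    rfl
  simp [totD, h]

theorem totD_comp_totSign (M : ChainComplex (ModuleCat.{u} Q) ℕ) :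
    totSign M ∘ₗ totD M = - (totD M ∘ₗ totSign M) := by
  refine DirectSum.linearMap_ext Q fun n => LinearMap.ext fun x => ?_
  rcases n with _ | n
  · simp [totD, totSign]
  · simp [totD, totSign, pow_succ]

theorem tPowD_comp_tPowD (k : ℕ) (M : ChainComplex (ModuleCat.{u} Q) ℕ) :
    tPowD k M ∘ₗ tPowD k M = 0 := by
  let F : Fin k → Fin k → (Tot M →ₗ[Q] Tot M) := fun i j =>
    if j < i then totSign M else if j = i then totD M else LinearMap.id
  have hF : ∀ i j : Fin k, i < j → PiTensorProduct.map (F i) ∘ₗ PiTensorProduct.map (F j) +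
      PiTensorProduct.map (F j) ∘ₗ PiTensorProduct.map (F i) = 0 := by
    intro i j hij
    have e : (fun l => F j l ∘ₗ F i l) = Function.update (fun l => F i l ∘ₗ F j l) i
        ((-1 : Q) • (F i i ∘ₗ F j i)) := by
      funext l
      by_cases h : l = i
      · subst h
        simp only [F, if_pos hij, lt_irrefl, if_false, if_true, Function.update_self,
          totD_comp_totSign]
        exact (neg_one_smul Q _).symm
      · rw [Function.update_of_ne h]
        rcases lt_or_gt_of_ne h with h1 | h1
        · simp [F, h1, h1.trans hij]
        · simp only [F, if_neg h1.asymm, if_neg h]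
          rfl
    rw [← PiTensorProduct.map_comp, ← PiTensorProduct.map_comp, e,
      PiTensorProduct.map_update_smul, Function.update_eq_self i (fun l => F i l ∘ₗ F j l)]
    refine LinearMap.ext fun y => ?_
    rw [LinearMap.add_apply, LinearMap.smul_apply]
    nth_rewrite 1 [← one_smul Q (PiTensorProduct.map (fun l => F i l ∘ₗ F j l) y)]
    rw [← add_smul, add_neg_cancel, zero_smul, LinearMap.zero_apply]
  have hF0 : ∀ i, PiTensorProduct.map (F i) ∘ₗ PiTensorProduct.map (F i) = 0 := by
    intro i
    rw [← PiTensorProduct.map_comp]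
    have e : (fun l => F i l ∘ₗ F i l) = Function.update (fun l => F i l ∘ₗ F i l) i
        ((0 : Q) • LinearMap.id) := by
      funext l
      by_cases h : l = i
      · subst h
        simp [F, totD_comp_totD]
      · rw [Function.update_of_ne h]
    rw [e, PiTensorProduct.map_update_smul, zero_smul]
  have hs : tPowD k M = ∑ i, PiTensorProduct.map (F i) := rfl
  rw [hs]
  have hp : (∑ i, PiTensorProduct.map (F i)) ∘ₗ (∑ i, PiTensorProduct.map (F i)) =
      ∑ p : Fin k × Fin k, PiTensorProduct.map (F p.1) ∘ₗ PiTensorProduct.map (F p.2) := by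
    rw [Fintype.sum_prod_type]
    exact Finset.sum_mul_sum (R := Module.End Q (TPow k M)) _ _ _ _
  rw [hp]
  refine Finset.sum_involution (fun p _ => p.swap) ?_ ?_ (fun _ _ => Finset.mem_univ _)
    (fun _ _ => Prod.swap_swap _)
  · rintro ⟨i, j⟩ -
    rcases lt_trichotomy i j with h | h | h
    · exact hF i j h
    · subst h
      simp [hF0]
    · rw [add_comm]
      exact hF j i h
  · rintro ⟨i, j⟩ - hne h
    obtain rfl : j = i := congrArg Prod.fst h
    exact hne (hF0 j)

theorem tPowMap_comp_tPowD (k : ℕ) {M N : ChainComplex (ModuleCat.{u} Q) ℕ} (f : M ⟶ N) :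
    tPowMap k f ∘ₗ tPowD k M = tPowD k N ∘ₗ tPowMap k f := by
  have hs : totMap f ∘ₗ totSign M = totSign N ∘ₗ totMap f :=
    DirectSum.linearMap_ext Q fun n => LinearMap.ext fun x => by simp [totMap, totSign]
  have hd : totMap f ∘ₗ totD M = totD N ∘ₗ totMap f := by
    refine DirectSum.linearMap_ext Q fun n => LinearMap.ext fun x => ?_
    have h : (f.f (n - 1)).hom ((M.d n (n - 1)).hom x) =
        (N.d n (n - 1)).hom ((f.f n).hom x) := by
      rw [← LinearMap.comp_apply, ← LinearMap.comp_apply, ← ModuleCat.hom_comp,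
        ← ModuleCat.hom_comp, f.comm]
    simp [totMap, totD, h]
  refine LinearMap.ext fun y => ?_
  simp only [tPowMap, tPowD, LinearMap.comp_apply, LinearMap.sum_apply, map_sum]
  refine Finset.sum_congr rfl fun i _ => ?_
  rw [← LinearMap.comp_apply, ← LinearMap.comp_apply, ← PiTensorProduct.map_comp,
    ← PiTensorProduct.map_comp]
  refine LinearMap.congr_fun (congrArg _ (funext fun j => ?_)) y
  split_ifs
  · exact hs
  · exact hd
  · rfl

theorem tPowMap_comp_tPowAct {k : ℕ} {M N : ChainComplex (ModuleCat.{u} Q) ℕ} (f : M ⟶ N)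
    (σ : Equiv.Perm (Fin k)) : tPowMap k f ∘ₗ tPowAct k M σ = tPowAct k N σ ∘ₗ tPowMap k f := by
  refine tPow_ext fun a x => ?_
  rw [LinearMap.comp_apply, LinearMap.comp_apply, tPowAct_homTensor, map_smul,
    tPowMap_homTensor, tPowMap_homTensor, tPowAct_homTensor]

theorem tPowMap_mem {k : ℕ} {M N : ChainComplex (ModuleCat.{u} Q) ℕ} (f : M ⟶ N) {n : ℕ}
    {y : TPow k M} (hy : y ∈ tPowDeg k M n) : tPowMap k f y ∈ tPowDeg k N n := by
  refine (Submodule.span_le (p := (tPowDeg k N n).comap (tPowMap k f))).2 ?_ hy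
  rintro _ ⟨a, ha, x, rfl⟩
  rw [SetLike.mem_coe, Submodule.mem_comap, tPowMap_homTensor]
  exact Submodule.subset_span ⟨a, ha, _, rfl⟩

/-! ### The naive exterior powers of complexes -/

/-- The part of degree `n` of `Λ^k_Q(M) = T^k(M)^(sign)`. -/
def extDeg (k : ℕ) (M : ChainComplex (ModuleCat.{u} Q) ℕ) (n : ℕ) : Submodule Q (TPow k M) :=
  tPowDeg k M n ⊓ signPart (tPowRep k M)

theorem tPowD_mem_extDeg {k : ℕ} (M : ChainComplex (ModuleCat.{u} Q) ℕ) {n : ℕ} {y : TPow k M}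
    (hy : y ∈ extDeg k M (n + 1)) : tPowD k M y ∈ extDeg k M n := by
  refine ⟨tPowD_mem M hy.1, fun σ => ?_⟩
  have h := LinearMap.congr_fun (tPowAct_comp_tPowD M σ) y
  have h' : tPowAct k M σ y = _ := hy.2 σ
  rw [LinearMap.comp_apply, LinearMap.comp_apply, h', map_smul] at h
  exact h

theorem tPowMap_mem_extDeg {k : ℕ} {M N : ChainComplex (ModuleCat.{u} Q) ℕ} (f : M ⟶ N) {n : ℕ}
    {y : TPow k M} (hy : y ∈ extDeg k M n) : tPowMap k f y ∈ extDeg k N n := by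
  refine ⟨tPowMap_mem f hy.1, fun σ => ?_⟩
  have h := LinearMap.congr_fun (tPowMap_comp_tPowAct f σ) y
  have h' : tPowAct k M σ y = _ := hy.2 σ
  rw [LinearMap.comp_apply, LinearMap.comp_apply, h', map_smul] at h
  exact h.symm

/-- The complex `Λ^k_Q(M) = T^k(M)^(sign)`. -/
def extPowerObj (k : ℕ) (M : ChainComplex (ModuleCat.{u} Q) ℕ) :
    ChainComplex (ModuleCat.{u} Q) ℕ where
  X n := ModuleCat.of Q (extDeg k M n)
  d i j := if h : j + 1 = i then
      ModuleCat.ofHom ((tPowD k M).restrict (p := extDeg k M i) (q := extDeg k M j)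
        (fun _ hy => tPowD_mem_extDeg M (h ▸ hy)))
    else 0
  shape i j h := dif_neg h
  d_comp_d' i j l hij hjl := by
    have hij' : j + 1 = i := hij
    have hjl' : l + 1 = j := hjl
    rw [dif_pos hij', dif_pos hjl']
    refine ModuleCat.hom_ext (LinearMap.ext fun y => Subtype.ext ?_)
    exact LinearMap.congr_fun (tPowD_comp_tPowD k M) (y : TPow k M)

end Complex

/-- `Λ^k_Q` on complexes of `Q`-modules concentrated in non-negative degrees. -/
def extPowerComplex (Q : Type u) [CommRing Q] (k : ℕ) :
    ChainComplex (ModuleCat.{u} Q) ℕ ⥤ ChainComplex (ModuleCat.{u} Q) ℕ where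
  obj M := extPowerObj k M
  map {M N} f :=
    { f := fun n => ModuleCat.ofHom ((tPowMap k f).restrict (p := extDeg k M n)
        (q := extDeg k N n) (fun _ hy => tPowMap_mem_extDeg f hy))
      comm' := fun i j hij => by
        have hij' : j + 1 = i := hij
        simp only [extPowerObj, dif_pos hij']
        refine ModuleCat.hom_ext (LinearMap.ext fun y => Subtype.ext ?_)
        exact (LinearMap.congr_fun (tPowMap_comp_tPowD k f) (y : TPow k M)).symm }
  map_id M := by
    have h : tPowMap k (𝟙 M) = LinearMap.id := tPow_ext fun a x => by
      rw [tPowMap_homTensor]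
      rfl
    ext n : 1
    refine ModuleCat.hom_ext (LinearMap.ext fun y => Subtype.ext ?_)
    exact LinearMap.congr_fun h (Subtype.val y)
  map_comp {M N P} f g := by
    have h : tPowMap k (f ≫ g) = tPowMap k g ∘ₗ tPowMap k f := tPow_ext fun a x => by
      rw [LinearMap.comp_apply, tPowMap_homTensor, tPowMap_homTensor, tPowMap_homTensor]
      rfl
    ext n : 1
    refine ModuleCat.hom_ext (LinearMap.ext fun y => Subtype.ext ?_)
    exact LinearMap.congr_fun h (Subtype.val y)

/-- The Dold-Puppe `k`-th exterior power `M ↦ N(Λ^k_Q(K(M)))` of complexes: `K` is the Dold-Puppe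
(Dold-Kan) functor and `N` the normalized Moore complex. -/
def doldPuppeExtPower (Q : Type u) [CommRing Q] (k : ℕ) :
    ChainComplex (ModuleCat.{u} Q) ℕ ⥤ ChainComplex (ModuleCat.{u} Q) ℕ :=
  Abelian.DoldKan.Γ ⋙ extPowerSimplicial Q k ⋙ AlgebraicTopology.normalizedMooreComplex _

end NaiveExteriorPower

end

noncomputable section

namespace NaiveExteriorPower

open AlgebraicTopology Opposite

/-! ### Tensor products of complexes, their chain maps and homotopies -/

section

variable {Q : Type u} [CommRing Q]

/-! ### Tensor products of families of linear maps -/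

section PiTensor

variable {ι : Type*} {s t : ι → Type u} [∀ i, AddCommGroup (s i)]
  [∀ i, Module Q (s i)] [∀ i, AddCommGroup (t i)] [∀ i, Module Q (t i)]

/-! The comparison map is the Eilenberg–Zilber shuffle map for `k` factors at once, restricted to
sign parts. Write `K[A]` for the alternating face map complex of `A`. A word `w` of length `n` in
the alphabet `Fin k` gives, for each letter `i`, a monotone surjection from `[n]` to `[m_i]`, with
`m_i` the number of occurrences of `i`. Normalized simplices of degrees `m_i` are pulled back along
these surjections and tensored; the shuffle map sums over all words, each weighted by its inversion
parity. Positive faces kill the sum, since words with two neighbouring letters exchanged cancel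
(`tensorFace_succ_comp_shuffleLin`). Face `0` strips the first letter and produces the Koszul
differential (`tensorFace_zero_comp_shuffleLin`). Relabelling the letters by a permutation changes
the parity by exactly the Koszul sign (`wordSign_perm`). Hence the map intertwines the signed action
on complexes with the unsigned action on simplicial modules (`permRep_comp_shuffleLin`) and
preserves sign parts.

That the shuffle map is a quasi-isomorphism (`quasiIso_shuffle`) is shown without an explicit
inverse. The decalage of `A` projects onto `A` by a degreewise split surjection and contracts onto
the constant object of vertices. Using it in one slot, with long exact sequences, extends the range
of degrees in which the shuffle map is an isomorphism on homology (`IsoBelow.succ`). Induction on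
the set of nonconstant slots reduces to constant simplicial modules, where only degree `0` matters.

Since `k!` is invertible, antisymmetrization exhibits the shuffle map on exterior powers as a
retract of the one on tensor powers (`extShuffleRetract`), and quasi-isomorphisms are closed under
retracts. It remains to connect `M` to the shuffle map: by Dold–Kan, `M` is naturally homotopy
equivalent to `K[Γ M]` (`doldKanUnit`), and homotopy equivalences survive tensor powers without any
flatness (`quasiIso_tensorMap`). The projection from the alternating complex to the normalized one
finishes the map. -/

/-- Multilinearity in one slot, phrased with three full families instead of `Function.update`, so
that families defined by `if` on the index can be compared slot by slot. -/
theorem map_eq_add_of_eq_off {f g h : ∀ i, s i →ₗ[Q] t i} (l : ι) (hl : f l = g l + h l)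
    (hg : ∀ i, i ≠ l → f i = g i) (hh : ∀ i, i ≠ l → f i = h i) :
    PiTensorProduct.map f = PiTensorProduct.map g + PiTensorProduct.map h := by
  classical
  have e1 : f = Function.update f l (g l + h l) := by rw [← hl, Function.update_eq_self]
  have e2 : g = Function.update f l (g l) := by
    funext i
    by_cases e : i = l
    · subst e; simp
    · rw [Function.update_of_ne e, hg i e]
  have e3 : h = Function.update f l (h l) := by
    funext i
    by_cases e : i = l
    · subst e; simp
    · rw [Function.update_of_ne e, hh i e]
  rw [e1, PiTensorProduct.map_update_add, ← e2, ← e3]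

theorem map_eq_zero_of_eq_zero {f : ∀ i, s i →ₗ[Q] t i} (l : ι) (hl : f l = 0) :
    PiTensorProduct.map f = 0 := by
  have := map_eq_add_of_eq_off (f := f) (g := f) (h := f) l (by rw [hl, add_zero])
    (fun _ _ => rfl) (fun _ _ => rfl)
  simpa using this

theorem map_add_map_eq_zero {f g : ∀ i, s i →ₗ[Q] t i} (l : ι) (hl : f l = - g l)
    (h : ∀ i, i ≠ l → f i = g i) : PiTensorProduct.map f + PiTensorProduct.map g = 0 := by
  classical
  let z : ∀ i, s i →ₗ[Q] t i := Function.update f l 0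
  have hz : PiTensorProduct.map z = 0 := map_eq_zero_of_eq_zero l (by simp [z])
  have := map_eq_add_of_eq_off (f := z) (g := f) (h := g) l (by simp [z, hl])
    (fun i hi => by simp [z, hi]) (fun i hi => by simp [z, hi, h i hi])
  rw [hz] at this
  exact this.symm

theorem map_smul_family [Fintype ι] (c : ι → Q) (f : ∀ i, s i →ₗ[Q] t i) :
    PiTensorProduct.map (fun i => c i • f i) = (∏ i, c i) • PiTensorProduct.map f := by
  refine PiTensorProduct.ext (MultilinearMap.ext fun x => ?_)
  simp [PiTensorProduct.map_tprod, MultilinearMap.map_smul_univ]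

end PiTensor

/-! ### Homogeneous maps of total modules -/

section Graded

variable {M N P : ChainComplex (ModuleCat.{u} Q) ℕ}

/-- The map of total modules given by linear maps `M_n → N_{n + e}`. -/
def gradedMap (e : ℕ) (f : ∀ n, M.X n →ₗ[Q] N.X (n + e)) : Tot M →ₗ[Q] Tot N :=
  DirectSum.toModule Q ℕ (Tot N) fun n => (DirectSum.lof Q ℕ (fun m => N.X m) (n + e)) ∘ₗ f n

@[simp]
theorem gradedMap_lof (e : ℕ) (f : ∀ n, M.X n →ₗ[Q] N.X (n + e)) (n : ℕ) (x : M.X n) :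
    gradedMap e f (DirectSum.lof Q ℕ (fun m => M.X m) n x) =
      DirectSum.lof Q ℕ (fun m => N.X m) (n + e) (f n x) := by
  simp [gradedMap]

@[simp]
theorem totMap_lof (f : M ⟶ N) (n : ℕ) (x : M.X n) :
    totMap f (DirectSum.lof Q ℕ (fun m => M.X m) n x) =
      DirectSum.lof Q ℕ (fun m => N.X m) n ((f.f n).hom x) := by
  simp [totMap]

@[simp]
theorem totSign_lof (n : ℕ) (x : M.X n) :
    totSign M (DirectSum.lof Q ℕ (fun m => M.X m) n x) =
      (-1 : Q) ^ n • DirectSum.lof Q ℕ (fun m => M.X m) n x := by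
  simp [totSign]

@[simp]
theorem totD_lof (n : ℕ) (x : M.X n) :
    totD M (DirectSum.lof Q ℕ (fun m => M.X m) n x) =
      DirectSum.lof Q ℕ (fun m => M.X m) (n - 1) ((M.d n (n - 1)).hom x) := by
  simp [totD]

theorem tot_ext {E : Type*} [AddCommGroup E] [Module Q E] {f g : Tot M →ₗ[Q] E}
    (h : ∀ n (x : M.X n), f (DirectSum.lof Q ℕ (fun m => M.X m) n x) =
      g (DirectSum.lof Q ℕ (fun m => M.X m) n x)) : f = g :=
  DirectSum.linearMap_ext Q fun n => LinearMap.ext fun x => h n x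

theorem totMap_comp (f : M ⟶ N) (g : N ⟶ P) : totMap (f ≫ g) = totMap g ∘ₗ totMap f :=
  tot_ext fun n x => by simp

theorem totMap_comp_totSign (f : M ⟶ N) : totMap f ∘ₗ totSign M = totSign N ∘ₗ totMap f :=
  tot_ext fun n x => by simp

theorem totSign_comp_totSign : totSign M ∘ₗ totSign M = LinearMap.id :=
  tot_ext fun n x => by simp [smul_smul, ← mul_pow]

theorem totMap_comp_totD (f : M ⟶ N) : totMap f ∘ₗ totD M = totD N ∘ₗ totMap f :=
  tot_ext fun n x => by
    have h : (f.f (n - 1)).hom ((M.d n (n - 1)).hom x) =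
        (N.d n (n - 1)).hom ((f.f n).hom x) := by
      rw [← LinearMap.comp_apply, ← LinearMap.comp_apply, ← ModuleCat.hom_comp,
        ← ModuleCat.hom_comp, f.comm]
    simp [h]

theorem totSign_comp_gradedMap_one (h : ∀ n, M.X n →ₗ[Q] N.X (n + 1)) :
    totSign N ∘ₗ gradedMap 1 h = - (gradedMap 1 h ∘ₗ totSign M) :=
  tot_ext fun n x => by simp [pow_succ]

theorem gradedMap_homotopy {f g : M ⟶ N} (h : Homotopy f g) :
    totMap f = totMap g + (totD N ∘ₗ gradedMap 1 (fun n => (h.hom n (n + 1)).hom) +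
      gradedMap 1 (fun n => (h.hom n (n + 1)).hom) ∘ₗ totD M) := by
  refine tot_ext fun n x => ?_
  have e := congrArg (fun φ => φ.hom x) (h.comm n)
  rcases n with _ | n
  -- Truncated subtraction makes `0 - 1` equal to `0`, so the second homotopy term passes through
  -- `M.d 0 0`, which is zero by `shape`.
  · have h0 : (M.d 0 (0 - 1)).hom x = 0 := by
      rw [M.shape _ _ (by simp)]; rfl
    simp only [Homotopy.dNext_zero_chainComplex, Homotopy.prevD_chainComplex] at e
    simp only [LinearMap.add_apply, LinearMap.comp_apply, totMap_lof, totD_lof, gradedMap_lof,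
      h0, map_zero, add_zero]
    rw [e]
    simp [add_comm]
  · simp only [Homotopy.dNext_succ_chainComplex, Homotopy.prevD_chainComplex] at e
    simp only [LinearMap.add_apply, LinearMap.comp_apply, totMap_lof, totD_lof, gradedMap_lof]
    rw [e]
    simp
    abel

end Graded

/-! ### The tensor product of a family of complexes -/

section Family

variable {k : ℕ}

/-- The underlying module of the tensor product of a family of complexes. -/
abbrev TensorTot (M : Fin k → ChainComplex (ModuleCat.{u} Q) ℕ) : Type u := ⨂[Q] i, Tot (M i)

/-- The part of degree `n` of the tensor product of a family of complexes. -/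
def tensorDeg (M : Fin k → ChainComplex (ModuleCat.{u} Q) ℕ) (n : ℕ) :
    Submodule Q (TensorTot M) :=
  Submodule.span Q {y | ∃ a : Fin k → ℕ, ∑ i, a i = n ∧ ∃ x : ∀ i, (M i).X (a i),
    y = PiTensorProduct.tprod Q fun i => DirectSum.lof Q ℕ (fun m => (M i).X m) (a i) (x i)}

/-- The differential of the tensor product of a family of complexes. -/
def tensorD (M : Fin k → ChainComplex (ModuleCat.{u} Q) ℕ) : TensorTot M →ₗ[Q] TensorTot M :=
  ∑ i : Fin k, PiTensorProduct.map fun j =>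
    if j < i then totSign (M j) else if j = i then totD (M j) else LinearMap.id

variable {M N P : Fin k → ChainComplex (ModuleCat.{u} Q) ℕ}

/-- Degree bookkeeping without subtraction: slot `i` lowers the degree by `s i` and raises it by `t
i`. The alternative that the image vanishes covers a differential leaving degree `0`. -/
theorem map_mem_tensorDeg (φ : ∀ i, Tot (M i) →ₗ[Q] Tot (N i)) (s t : Fin k → ℕ) {n m : ℕ}
    (hφ : ∀ i a (x : (M i).X a), φ i (DirectSum.lof Q ℕ (fun m => (M i).X m) a x) = 0 ∨
      ∃ b, b + s i = a + t i ∧ ∃ y : (N i).X b,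
        φ i (DirectSum.lof Q ℕ (fun m => (M i).X m) a x) =
          DirectSum.lof Q ℕ (fun m => (N i).X m) b y)
    (h : m + ∑ i, s i = n + ∑ i, t i) {y : TensorTot M} (hy : y ∈ tensorDeg M n) :
    PiTensorProduct.map φ y ∈ tensorDeg N m := by
  refine (Submodule.span_le (p := (tensorDeg N m).comap (PiTensorProduct.map φ))).2 ?_ hy
  rintro _ ⟨a, ha, x, rfl⟩
  rw [SetLike.mem_coe, Submodule.mem_comap, PiTensorProduct.map_tprod]
  by_cases h0 : ∃ i, φ i (DirectSum.lof Q ℕ (fun m => (M i).X m) (a i) (x i)) = 0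
  · obtain ⟨i, hi⟩ := h0
    rw [MultilinearMap.map_coord_zero _ i hi]
    exact Submodule.zero_mem _
  · have key := fun i => (hφ i (a i) (x i)).resolve_left fun e => h0 ⟨i, e⟩
    choose b hb y hy using key
    refine Submodule.subset_span ⟨b, ?_, y, congrArg _ (funext hy)⟩
    have := Finset.sum_congr rfl fun i (_ : i ∈ Finset.univ) => hb i
    rw [Finset.sum_add_distrib, Finset.sum_add_distrib] at this
    omega

theorem tensorD_mem {n : ℕ} {y : TensorTot M} (hy : y ∈ tensorDeg M (n + 1)) :
    tensorD M y ∈ tensorDeg M n := by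
  rw [tensorD, LinearMap.sum_apply]
  refine Submodule.sum_mem _ fun i _ => ?_
  refine map_mem_tensorDeg _ (fun j => if j = i then 1 else 0) 0 ?_ (by simp) hy
  intro j a x
  rcases lt_trichotomy j i with h | h | h
  · right
    exact ⟨a, by simp [h.ne], (-1 : Q) ^ a • x, by simp [h]⟩
  · subst h
    rcases a with _ | a
    · left
      simp only [lt_self_iff_false, if_true, if_false, totD_lof]
      rw [(M j).shape _ _ (by simp)]
      simp
    · right
      exact ⟨a, by simp, _, by simp only [lt_self_iff_false, if_true, if_false, totD_lof]; rfl⟩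
  · right
    exact ⟨a, by simp [h.ne'], x, by simp [h.ne', h.asymm]⟩

/-- The summands for `(i, j)` and `(j, i)` differ only in slot `min i j`, where the sign operator
and the differential meet in opposite orders and anticommute. The diagonal summands contain the
square of a differential. -/
theorem tensorD_comp_tensorD (M : Fin k → ChainComplex (ModuleCat.{u} Q) ℕ) :
    tensorD M ∘ₗ tensorD M = 0 := by
  let F : ∀ i j : Fin k, Tot (M j) →ₗ[Q] Tot (M j) := fun i j =>
    if j < i then totSign (M j) else if j = i then totD (M j) else LinearMap.id
  have hF : ∀ i j : Fin k, i < j → PiTensorProduct.map (F i) ∘ₗ PiTensorProduct.map (F j) +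
      PiTensorProduct.map (F j) ∘ₗ PiTensorProduct.map (F i) = 0 := by
    intro i j hij
    rw [← PiTensorProduct.map_comp, ← PiTensorProduct.map_comp]
    refine map_add_map_eq_zero i ?_ ?_
    · simp [F, hij, totD_comp_totSign]
    · intro l h
      rcases lt_or_gt_of_ne h with h1 | h1
      · simp [F, h1, h1.trans hij]
      · simp only [F, if_neg h1.asymm, if_neg h]
        rfl
  have hF0 : ∀ i, PiTensorProduct.map (F i) ∘ₗ PiTensorProduct.map (F i) = 0 := by
    intro i
    rw [← PiTensorProduct.map_comp]
    exact map_eq_zero_of_eq_zero i (by simp [F, totD_comp_totD])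
  have hp : tensorD M ∘ₗ tensorD M =
      ∑ p : Fin k × Fin k, PiTensorProduct.map (F p.1) ∘ₗ PiTensorProduct.map (F p.2) := by
    rw [Fintype.sum_prod_type]
    exact Finset.sum_mul_sum (R := Module.End Q (TensorTot M)) _ _ _ _
  rw [hp]
  refine Finset.sum_involution (fun p _ => p.swap) ?_ ?_ (fun _ _ => Finset.mem_univ _)
    (fun _ _ => Prod.swap_swap _)
  · rintro ⟨i, j⟩ -
    rcases lt_trichotomy i j with h | h | h
    · exact hF i j h
    · subst h
      simp [hF0]
    · rw [add_comm]
      exact hF j i h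
  · rintro ⟨i, j⟩ - hne h
    obtain rfl : j = i := congrArg Prod.fst h
    exact hne (hF0 j)

/-- The tensor product of a family of complexes. -/
def tensorComplex (M : Fin k → ChainComplex (ModuleCat.{u} Q) ℕ) :
    ChainComplex (ModuleCat.{u} Q) ℕ where
  X n := ModuleCat.of Q (tensorDeg M n)
  d i j := if h : j + 1 = i then
      ModuleCat.ofHom ((tensorD M).restrict (p := tensorDeg M i) (q := tensorDeg M j)
        (fun _ hy => tensorD_mem (h ▸ hy)))
    else 0
  shape i j h := dif_neg h
  d_comp_d' i j l hij hjl := by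
    have hij' : j + 1 = i := hij
    have hjl' : l + 1 = j := hjl
    rw [dif_pos hij', dif_pos hjl']
    refine ModuleCat.hom_ext (LinearMap.ext fun y => Subtype.ext ?_)
    exact LinearMap.congr_fun (tensorD_comp_tensorD M) (y : TensorTot M)

theorem tensorComplex_d (M : Fin k → ChainComplex (ModuleCat.{u} Q) ℕ) (n : ℕ) :
    (tensorComplex M).d (n + 1) n =
      ModuleCat.ofHom ((tensorD M).restrict (p := tensorDeg M (n + 1)) (q := tensorDeg M n)
        (fun _ hy => tensorD_mem hy)) :=
  dif_pos rfl

/-- The components need not commute with differentials: this allows degreewise sections and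
retractions to be tensored later. The shift `0` works because `n + 0` reduces to `n`. -/
theorem map_gradedMap_mem (φ : ∀ i n, (M i).X n →ₗ[Q] (N i).X n) {n : ℕ} {y : TensorTot M}
    (hy : y ∈ tensorDeg M n) :
    PiTensorProduct.map (fun i => gradedMap 0 (φ i)) y ∈ tensorDeg N n :=
  map_mem_tensorDeg _ 0 0 (fun i a x => Or.inr ⟨a, rfl, φ i a x, by simp⟩) rfl hy

/-- The map of tensor products, in degree `n`, given by degree-preserving linear maps. -/
def tensorMapX (φ : ∀ i n, (M i).X n →ₗ[Q] (N i).X n) (n : ℕ) :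
    (tensorComplex M).X n ⟶ (tensorComplex N).X n :=
  ModuleCat.ofHom ((PiTensorProduct.map fun i => gradedMap 0 (φ i)).restrict
    (p := tensorDeg M n) (q := tensorDeg N n) fun _ hy => map_gradedMap_mem φ hy)

theorem map_totMap_comp_tensorD (f : ∀ i, M i ⟶ N i) :
    PiTensorProduct.map (fun i => totMap (f i)) ∘ₗ tensorD M =
      tensorD N ∘ₗ PiTensorProduct.map fun i => totMap (f i) := by
  refine LinearMap.ext fun y => ?_
  simp only [tensorD, LinearMap.comp_apply, LinearMap.sum_apply, map_sum]
  refine Finset.sum_congr rfl fun i _ => ?_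
  rw [← LinearMap.comp_apply, ← LinearMap.comp_apply, ← PiTensorProduct.map_comp,
    ← PiTensorProduct.map_comp]
  refine LinearMap.congr_fun (congrArg _ (funext fun j => ?_)) y
  split_ifs
  · exact totMap_comp_totSign _
  · exact totMap_comp_totD _
  · rfl

/-- The chain map of tensor products induced by a family of chain maps. -/
def tensorMap (f : ∀ i, M i ⟶ N i) : tensorComplex M ⟶ tensorComplex N where
  f n := tensorMapX (fun i n => ((f i).f n).hom) n
  comm' i j hij := by
    obtain rfl : j + 1 = i := hij
    rw [tensorComplex_d, tensorComplex_d]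
    refine ModuleCat.hom_ext (LinearMap.ext fun y => Subtype.ext ?_)
    exact (LinearMap.congr_fun (map_totMap_comp_tensorD f) (Subtype.val y)).symm

theorem tensorMapX_id (n : ℕ) :
    tensorMapX (M := M) (fun _ _ => LinearMap.id) n = 𝟙 _ := by
  refine ModuleCat.hom_ext (LinearMap.ext fun y => Subtype.ext ?_)
  have : (fun i => gradedMap (M := M i) 0 fun _ => LinearMap.id) = fun i => LinearMap.id :=
    funext fun i => tot_ext fun n x => by simp
  change PiTensorProduct.map (fun i => gradedMap (M := M i) 0 fun _ => LinearMap.id) _ = _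
  rw [this, PiTensorProduct.map_id]
  rfl

theorem tensorMapX_comp (φ : ∀ i n, (M i).X n →ₗ[Q] (N i).X n)
    (ψ : ∀ i n, (N i).X n →ₗ[Q] (P i).X n) (n : ℕ) :
    tensorMapX φ n ≫ tensorMapX ψ n = tensorMapX (fun i n => ψ i n ∘ₗ φ i n) n := by
  refine ModuleCat.hom_ext (LinearMap.ext fun y => Subtype.ext ?_)
  have : (fun i => gradedMap 0 fun n => ψ i n ∘ₗ φ i n) =
      fun i => gradedMap 0 (ψ i) ∘ₗ gradedMap 0 (φ i) :=
    funext fun i => tot_ext fun n x => by simp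
  change _ = PiTensorProduct.map (fun i => gradedMap 0 fun n => ψ i n ∘ₗ φ i n) _
  rw [this, PiTensorProduct.map_comp]
  rfl

theorem tensorMapX_eq_add {f g h : ∀ i n, (M i).X n →ₗ[Q] (N i).X n} (l : Fin k)
    (hl : f l = g l + h l) (hg : ∀ i, i ≠ l → f i = g i) (hh : ∀ i, i ≠ l → f i = h i) (n : ℕ) :
    tensorMapX f n = tensorMapX g n + tensorMapX h n := by
  refine ModuleCat.hom_ext (LinearMap.ext fun y => Subtype.ext ?_)
  refine LinearMap.congr_fun (map_eq_add_of_eq_off l ?_ ?_ ?_) (Subtype.val y)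
  · rw [hl]
    exact tot_ext fun n x => by simp
  · exact fun i hi => by rw [hg i hi]
  · exact fun i hi => by rw [hh i hi]

theorem tensorMapX_eq_zero {f : ∀ i n, (M i).X n →ₗ[Q] (N i).X n} (l : Fin k)
    (hl : f l = 0) (n : ℕ) : tensorMapX f n = 0 := by
  simpa using tensorMapX_eq_add (f := f) (g := f) (h := f) l (by rw [hl, add_zero])
    (fun _ _ => rfl) (fun _ _ => rfl) n

theorem tensorMap_id : tensorMap (fun i => 𝟙 (M i)) = 𝟙 _ := by
  ext n : 1
  exact tensorMapX_id n

theorem tensorMap_comp (f : ∀ i, M i ⟶ N i) (g : ∀ i, N i ⟶ P i) :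
    tensorMap (fun i => f i ≫ g i) = tensorMap f ≫ tensorMap g := by
  ext n : 1
  exact (tensorMapX_comp _ _ n).symm

end Family

/-! ### Homotopies between tensor products of chain maps -/

section TensorHomotopy

variable {k : ℕ} {M N : Fin k → ChainComplex (ModuleCat.{u} Q) ℕ}

/-- Total degree `0` forces every factor into degree `0`, where the differential is zero. This
supplies the missing term of the homotopy identity in degree `0`. -/
theorem tensorD_eq_zero {y : TensorTot M} (hy : y ∈ tensorDeg M 0) : tensorD M y = 0 := by
  rw [tensorD, LinearMap.sum_apply]
  refine Finset.sum_eq_zero fun i _ => ?_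
  refine (Submodule.span_le (p := LinearMap.ker (PiTensorProduct.map fun j =>
    if j < i then totSign (M j) else if j = i then totD (M j) else LinearMap.id))).2 ?_ hy
  rintro _ ⟨a, ha, x, rfl⟩
  rw [SetLike.mem_coe, LinearMap.mem_ker, PiTensorProduct.map_tprod]
  refine MultilinearMap.map_coord_zero _ i ?_
  have hi : a i = 0 := Finset.sum_eq_zero_iff.1 ha i (Finset.mem_univ i)
  simp only [lt_self_iff_false, if_true, if_false, totD_lof]
  rw [(M i).shape _ _ (by simp [hi])]
  simp

/-- The operator that applies `η` to the factor `l`, with the Koszul sign, and chain maps to the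
other factors. -/
def slotOp (l : Fin k) (f : ∀ i, M i ⟶ N i) (η : ∀ i n, (M i).X n →ₗ[Q] (N i).X (n + 1)) :
    TensorTot M →ₗ[Q] TensorTot N :=
  PiTensorProduct.map fun j => if j < l then totSign (N j) ∘ₗ totMap (f j) else
    if j = l then gradedMap 1 (η j) else totMap (f j)

theorem slotOp_mem (l : Fin k) (f : ∀ i, M i ⟶ N i)
    (η : ∀ i n, (M i).X n →ₗ[Q] (N i).X (n + 1)) {n : ℕ} {y : TensorTot M}
    (hy : y ∈ tensorDeg M n) : slotOp l f η y ∈ tensorDeg N (n + 1) := by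
  refine map_mem_tensorDeg _ 0 (fun j => if j = l then 1 else 0) ?_ (by simp) hy
  intro j a x
  right
  rcases lt_trichotomy j l with h | h | h
  · exact ⟨a, by simp [h.ne], (-1 : Q) ^ a • ((f j).f a).hom x, by simp [h]⟩
  · subst h
    exact ⟨a + 1, by simp, η j a x, by simp⟩
  · exact ⟨a, by simp [h.ne'], ((f j).f a).hom x, by simp [h.ne', h.asymm]⟩

/-- The summand of the tensor differential in a slot other than `l` anticommutes with `slotOp`, by
the Koszul sign in the smaller of the two slots. Only the summand in slot `l` remains; there the
signs in earlier slots square to `1` and slot `l` carries `dη + ηd`. -/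
theorem slotOp_homotopy (l : Fin k) (f g : ∀ i, M i ⟶ N i)
    (η : ∀ i n, (M i).X n →ₗ[Q] (N i).X (n + 1)) (hfg : ∀ i, i ≠ l → f i = g i)
    (h : totMap (f l) = totMap (g l) +
      (totD (N l) ∘ₗ gradedMap 1 (η l) + gradedMap 1 (η l) ∘ₗ totD (M l))) :
    PiTensorProduct.map (fun i => totMap (f i)) =
      PiTensorProduct.map (fun i => totMap (g i)) +
      (tensorD N ∘ₗ slotOp l f η + slotOp l f η ∘ₗ tensorD M) := by
  let F (K : Fin k → ChainComplex (ModuleCat.{u} Q) ℕ) (i j : Fin k) : Tot (K j) →ₗ[Q] Tot (K j) :=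
    if j < i then totSign (K j) else if j = i then totD (K j) else LinearMap.id
  have e1 : ∀ i, i ≠ l → PiTensorProduct.map (F N i) ∘ₗ slotOp l f η +
      slotOp l f η ∘ₗ PiTensorProduct.map (F M i) = 0 := by
    intro i hi
    rw [slotOp, ← PiTensorProduct.map_comp, ← PiTensorProduct.map_comp]
    rcases lt_or_gt_of_ne hi with h1 | h1
    · refine map_add_map_eq_zero i ?_ fun j hj => ?_
      · simp only [F, lt_self_iff_false, if_false, if_true, h1]
        rw [LinearMap.comp_assoc, totMap_comp_totD, ← LinearMap.comp_assoc, ← LinearMap.comp_assoc,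
          totD_comp_totSign, LinearMap.neg_comp, neg_neg]
      · rcases lt_trichotomy j l with h2 | rfl | h2
        · rcases lt_or_gt_of_ne hj with h3 | h3
          · simp only [F, h2, h3, if_true]
            rw [LinearMap.comp_assoc (totSign (M j)), totMap_comp_totSign]
          · simp only [F, h2, h3.asymm, hj, if_true, if_false, LinearMap.id_comp,
              LinearMap.comp_id]
        · simp only [F, hj, h1.asymm, if_true, if_false, LinearMap.id_comp, LinearMap.comp_id]
        · simp only [F, hj, (h1.trans h2).asymm, h2.asymm, h2.ne', if_false, LinearMap.id_comp,
            LinearMap.comp_id]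
    · refine map_add_map_eq_zero l ?_ fun j hj => ?_
      · simp only [F, lt_self_iff_false, if_false, if_true, h1]
        exact totSign_comp_gradedMap_one _
      · rcases lt_trichotomy j i with h2 | rfl | h2
        · rcases lt_or_gt_of_ne hj with h3 | h3
          · simp only [F, h2, h3, if_true]
            rw [LinearMap.comp_assoc (totSign (M j)), totMap_comp_totSign]
          · simp only [F, h2, h3.asymm, hj, if_true, if_false, totMap_comp_totSign]
        · simp only [F, hj, h1.asymm, lt_self_iff_false, if_true, if_false, totMap_comp_totD]
        · simp only [F, hj, h2.ne', (h1.trans h2).asymm, h2.asymm, if_false, LinearMap.id_comp,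
            LinearMap.comp_id]
  have e2 : PiTensorProduct.map (fun i => totMap (f i)) =
      PiTensorProduct.map (fun i => totMap (g i)) +
      (PiTensorProduct.map (F N l) ∘ₗ slotOp l f η +
        slotOp l f η ∘ₗ PiTensorProduct.map (F M l)) := by
    rw [slotOp, ← PiTensorProduct.map_comp, ← PiTensorProduct.map_comp]
    -- The difference of the two tensor maps: multilinearity is applied once to split `f` into `g`
    -- and `X`, and once more to split `X` into its two homotopy terms.
    let X (j : Fin k) : Tot (M j) →ₗ[Q] Tot (N j) := if j = l then
      (totD (N j) ∘ₗ gradedMap 1 (η j) + gradedMap 1 (η j) ∘ₗ totD (M j)) else totMap (f j)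
    have eX := map_eq_add_of_eq_off (f := fun i => totMap (f i)) (g := fun i => totMap (g i))
      (h := X) l (by simp [X, h]) (fun i hi => by rw [hfg i hi]) (fun i hi => by simp [X, hi])
    rw [eX]
    congr 1
    refine map_eq_add_of_eq_off l ?_ (fun j hj => ?_) fun j hj => ?_
    · simp [X, F]
    · rcases lt_or_gt_of_ne hj with h3 | h3
      · simp only [X, F, hj, h3, if_true, if_false]
        rw [← LinearMap.comp_assoc, totSign_comp_totSign, LinearMap.id_comp]
      · simp only [X, F, hj, h3.asymm, if_false, LinearMap.id_comp]
    · rcases lt_or_gt_of_ne hj with h3 | h3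
      · simp only [X, F, hj, h3, if_true, if_false]
        rw [LinearMap.comp_assoc, totMap_comp_totSign, ← LinearMap.comp_assoc,
          totSign_comp_totSign, LinearMap.id_comp]
      · simp only [X, F, hj, h3.asymm, if_false, LinearMap.comp_id]
  have e3 : tensorD N ∘ₗ slotOp l f η + slotOp l f η ∘ₗ tensorD M =
      PiTensorProduct.map (F N l) ∘ₗ slotOp l f η +
        slotOp l f η ∘ₗ PiTensorProduct.map (F M l) := by
    have e4 : tensorD N ∘ₗ slotOp l f η + slotOp l f η ∘ₗ tensorD M =
        ∑ i, (PiTensorProduct.map (F N i) ∘ₗ slotOp l f η +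
          slotOp l f η ∘ₗ PiTensorProduct.map (F M i)) := by
      refine LinearMap.ext fun y => ?_
      simp only [tensorD, LinearMap.add_apply, LinearMap.comp_apply, LinearMap.sum_apply, map_sum,
        Finset.sum_add_distrib]
      rfl
    rw [e4]
    exact Finset.sum_eq_single l (fun i _ hi => e1 i hi) (fun h => absurd (Finset.mem_univ l) h)
  rw [e3]
  exact e2

/-- The components of `slotOp`, as morphisms between the terms of the tensor products. -/
def slotHom (l : Fin k) (f : ∀ i, M i ⟶ N i) (η : ∀ i n, (M i).X n →ₗ[Q] (N i).X (n + 1))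
    (i j : ℕ) : (tensorComplex M).X i ⟶ (tensorComplex N).X j :=
  if e : i + 1 = j then
    ModuleCat.ofHom ((slotOp l f η).restrict (p := tensorDeg M i) (q := tensorDeg N j)
      (fun _ hy => e ▸ slotOp_mem l f η hy))
  else 0

theorem slotHom_succ (l : Fin k) (f : ∀ i, M i ⟶ N i)
    (η : ∀ i n, (M i).X n →ₗ[Q] (N i).X (n + 1)) (n : ℕ) :
    slotHom l f η n (n + 1) =
      ModuleCat.ofHom ((slotOp l f η).restrict (p := tensorDeg M n) (q := tensorDeg N (n + 1))
        (fun _ hy => slotOp_mem l f η hy)) :=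
  dif_pos rfl

/-- Two families of chain maps that differ by a homotopy in one factor induce homotopic maps of
tensor products. -/
def tensorMapHomotopy (l : Fin k) (f g : ∀ i, M i ⟶ N i)
    (η : ∀ i n, (M i).X n →ₗ[Q] (N i).X (n + 1)) (hfg : ∀ i, i ≠ l → f i = g i)
    (h : totMap (f l) = totMap (g l) +
      (totD (N l) ∘ₗ gradedMap 1 (η l) + gradedMap 1 (η l) ∘ₗ totD (M l))) :
    Homotopy (tensorMap f) (tensorMap g) where
  hom := slotHom l f η
  zero i j hij := dif_neg hij
  comm n := by
    have key := slotOp_homotopy l f g η hfg h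
    rcases n with _ | n
    · rw [Homotopy.dNext_zero_chainComplex, Homotopy.prevD_chainComplex, slotHom_succ,
        tensorComplex_d]
      refine ModuleCat.hom_ext (LinearMap.ext fun y => Subtype.ext ?_)
      have := LinearMap.congr_fun key (Subtype.val y)
      simp only [LinearMap.add_apply, LinearMap.comp_apply, tensorD_eq_zero (Subtype.prop y),
        map_zero, add_zero] at this
      have comm : ∀ a b : TensorTot N, a + b = (0 + b) + a := by
        intro a b
        abel
      exact this.trans (comm _ _)
    · rw [Homotopy.dNext_succ_chainComplex, Homotopy.prevD_chainComplex, slotHom_succ, slotHom_succ,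
        tensorComplex_d, tensorComplex_d]
      refine ModuleCat.hom_ext (LinearMap.ext fun y => Subtype.ext ?_)
      have := LinearMap.congr_fun key (Subtype.val y)
      have comm : ∀ a b c : TensorTot N, a + (b + c) = (c + b) + a := by
        intro a b c
        abel
      exact this.trans (comm _ _ _)

/-- The factors are exchanged one at a time; `S` is the set of slots that carry `f`. -/
theorem tensorMap_homotopic (f g : ∀ i, M i ⟶ N i) (h : ∀ i, Homotopy (f i) (g i)) :
    Nonempty (Homotopy (tensorMap f) (tensorMap g)) := by
  classical
  have key : ∀ S : Finset (Fin k),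
      Nonempty (Homotopy (tensorMap fun i => if i ∈ S then f i else g i) (tensorMap g)) := by
    intro S
    induction S using Finset.induction_on with
    | empty => exact ⟨Homotopy.ofEq (by simp)⟩
    | insert l S hl ih =>
      obtain ⟨ih⟩ := ih
      refine ⟨Homotopy.trans (tensorMapHomotopy l _ _ (fun i n => ((h i).hom n (n + 1)).hom)
        (fun i hi => ?_) ?_) ih⟩
      · simp [hi]
      · simp only [Finset.mem_insert_self, if_true, hl, if_false]
        exact gradedMap_homotopy (h l)
  simpa using key Finset.univ

/-- Homotopy equivalences are assumed because a tensor product of quasi-isomorphisms need not be one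
when the modules are not flat. -/
theorem quasiIso_tensorMap (f : ∀ i, HomotopyEquiv (M i) (N i)) :
    QuasiIso (tensorMap fun i => (f i).hom) := by
  obtain ⟨h1⟩ := tensorMap_homotopic _ _ fun i => (f i).homotopyHomInvId
  obtain ⟨h2⟩ := tensorMap_homotopic _ _ fun i => (f i).homotopyInvHomId
  rw [tensorMap_comp, tensorMap_id] at h1 h2
  exact (HomotopyEquiv.mk (tensorMap fun i => (f i).hom) (tensorMap fun i => (f i).inv)
    h1 h2).quasiIso_hom

end TensorHomotopy

end

/-! ### Words and their signs -/

section Words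

variable {n k : ℕ}

/-- The sign of a word `w` in the ordered alphabet `Fin k`: the parity of its number of
inversions. -/
def wordSign (w : Fin n → Fin k) : ℤ := ∏ l, ∏ m, if l < m ∧ w m < w l then -1 else 1

/-- The number of occurrences of `true`. -/
def letterCount (u : Fin n → Bool) : ℕ := ∑ l, if u l then 1 else 0

theorem letterCount_cons (b : Bool) (u : Fin n → Bool) :
    letterCount (Fin.cons b u : Fin (n + 1) → Bool) = (if b then 1 else 0) + letterCount u := by
  simp only [letterCount, Fin.sum_univ_succ, Fin.cons_zero, Fin.cons_succ]

theorem cons_decide (b : Fin k) (w : Fin n → Fin k) (j : Fin k) :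
    (fun l => decide ((Fin.cons b w : Fin (n + 1) → Fin k) l = j)) =
      (Fin.cons (decide (b = j)) (fun l => decide (w l = j)) : Fin (n + 1) → Bool) := by
  funext l
  refine Fin.cases ?_ (fun l => ?_) l <;> simp

theorem comp_cons {α β : Type*} (f : α → β) (b : α) (w : Fin n → α) :
    (fun l => f ((Fin.cons b w : Fin (n + 1) → α) l)) =
      (Fin.cons (f b) (fun l => f (w l)) : Fin (n + 1) → β) := by
  funext l
  refine Fin.cases ?_ (fun l => ?_) l <;> simp

/-- Groups the positions of a word by letter. This turns inversion counts into powers indexed by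
multiplicities, which are the degrees of the tensor factors. -/
theorem prod_comp_word {R : Type*} [CommMonoid R] (g : Fin k → R) (w : Fin n → Fin k) :
    ∏ m, g (w m) = ∏ j, g j ^ letterCount (fun l => decide (w l = j)) := by
  have h1 : ∀ m, g (w m) = ∏ j, if w m = j then g j else 1 := fun m => by simp
  have h2 : ∀ j, g j ^ letterCount (fun l => decide (w l = j)) =
      ∏ m, if w m = j then g j else 1 := fun j => by
    rw [letterCount, ← Finset.prod_pow_eq_pow_sum]
    refine Finset.prod_congr rfl fun m _ => ?_
    by_cases h : w m = j <;> simp [h]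
  rw [Finset.prod_congr rfl fun m _ => h1 m, Finset.prod_comm]
  exact Finset.prod_congr rfl fun j _ => (h2 j).symm

theorem wordSign_cons (b : Fin k) (w : Fin n → Fin k) :
    wordSign (Fin.cons b w : Fin (n + 1) → Fin k) =
      (∏ m, if w m < b then -1 else 1) * wordSign w := by
  simp [wordSign, Fin.prod_univ_succ]

/-- The inversions of the first letter, grouped by value, form exactly the Koszul sign of the
differential in slot `b`. -/
theorem wordSign_cons' (b : Fin k) (w : Fin n → Fin k) :
    wordSign (Fin.cons b w : Fin (n + 1) → Fin k) =
      (∏ j, if j < b then (-1) ^ letterCount (fun l => decide (w l = j)) else 1) * wordSign w := by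
  rw [wordSign_cons, prod_comp_word (fun j => if j < b then (-1 : ℤ) else 1) w]
  congr 1
  refine Finset.prod_congr rfl fun j _ => ?_
  split_ifs <;> simp

/-- If the first two letters are exchanged, only the inversion status of that pair changes.
Otherwise the first letter is peeled off: its number of inversions does not depend on the order of
the remaining letters. -/
theorem wordSign_swap : ∀ {n : ℕ} (w : Fin (n + 1) → Fin k) (i : Fin n)
    (_ : w i.castSucc ≠ w i.succ),
    wordSign (w ∘ Equiv.swap i.castSucc i.succ) = - wordSign w
  | 0, _, i, _ => i.elim0
  | n + 1, w, i, h => by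
    obtain ⟨a, w, rfl⟩ : ∃ a w', w = Fin.cons a w' := ⟨w 0, Fin.tail w, (Fin.cons_self_tail w).symm⟩
    refine Fin.cases (fun h => ?_) (fun i h => ?_) i h
    · obtain ⟨b, w, rfl⟩ : ∃ b w', w = Fin.cons b w' :=
        ⟨w 0, Fin.tail w, (Fin.cons_self_tail w).symm⟩
      have e : (Fin.cons a (Fin.cons b w : Fin (n + 1) → Fin k) : Fin (n + 2) → Fin k) ∘
          Equiv.swap (Fin.castSucc 0) (Fin.succ 0) =
          (Fin.cons b (Fin.cons a w : Fin (n + 1) → Fin k) : Fin (n + 2) → Fin k) := by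
        funext l
        refine Fin.cases ?_ (fun l => ?_) l
        · simp
        · refine Fin.cases ?_ (fun l => ?_) l
          · simp
          · rw [Function.comp_apply, Equiv.swap_apply_of_ne_of_ne]
            · simp
            · exact Fin.succ_ne_zero _
            · exact fun e => Fin.succ_ne_zero _ (Fin.succ_injective _ e)
      rw [e]
      simp only [wordSign_cons, Fin.prod_univ_succ, Fin.cons_zero, Fin.cons_succ]
      have hab : a ≠ b := by simpa using h
      rcases lt_or_gt_of_ne hab with h1 | h1 <;>
        simp only [h1, h1.asymm, if_true, if_false] <;> ring
    · have e : (Fin.cons a w : Fin (n + 2) → Fin k) ∘ Equiv.swap i.succ.castSucc i.succ.succ =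
          Fin.cons a (w ∘ Equiv.swap i.castSucc i.succ) := by
        funext l
        refine Fin.cases ?_ (fun l => ?_) l
        · rw [Function.comp_apply, Equiv.swap_apply_of_ne_of_ne]
          · simp
          · exact fun e => by simp [Fin.ext_iff] at e
          · exact (Fin.succ_ne_zero _).symm
        · rw [← Fin.succ_castSucc, Function.comp_apply, (Fin.succ_injective _).swap_apply]
          simp
      rw [e, wordSign_cons, wordSign_cons, wordSign_swap w i (by simpa using h)]
      have := Equiv.prod_comp (Equiv.swap i.castSucc i.succ)
        (fun m => if w m < a then (-1 : ℤ) else 1)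
      simp only [Function.comp_apply]
      rw [this]
      ring

/-- For letters `i < j` that `σ` inverts, all pairs of positions carrying `i` and `j` change their
inversion status, and there are `c i * c j` of them. The proof removes the first letter and compares
with `koszulSign_update`. -/
theorem wordSign_perm (σ : Equiv.Perm (Fin k)) : ∀ {n : ℕ} (w : Fin n → Fin k),
    wordSign (fun l => σ (w l)) =
      wordSign w * koszulSign σ (fun j => letterCount (fun l => decide (w l = j)))
  | 0, w => by simp [wordSign, koszulSign, letterCount]
  | n + 1, w => by
    obtain ⟨b, w, rfl⟩ : ∃ a w', w = Fin.cons a w' := ⟨w 0, Fin.tail w, (Fin.cons_self_tail w).symm⟩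
    set c : Fin k → ℕ := fun j => letterCount (fun l => decide (w l = j)) with hc
    set c' : Fin k → ℕ := fun j =>
      letterCount (fun l => decide ((Fin.cons b w : Fin (n + 1) → Fin k) l = j)) with hc'
    have hcc : ∀ j, c' j = (if b = j then 1 else 0) + c j := fun j => by
      simp only [hc', cons_decide, letterCount_cons, hc]
      simp
    have hu : Function.update c' b (c' b - 1) = c := by
      funext j
      by_cases h : j = b
      · subst h
        -- The multiplicity of `b` drops by one when the first letter is removed.
        simp [hcc]
      · simp [h, hcc, Ne.symm h]
    have key := koszulSign_update σ c' b (by simp [hcc])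
    rw [hu] at key
    have e1 : (∏ l, if l < b then (-1 : ℤ) ^ c' l else 1) =
        ∏ j, if j < b then (-1 : ℤ) ^ c j else 1 := by
      refine Finset.prod_congr rfl fun j _ => ?_
      by_cases h : j < b
      · simp [h, hcc, h.ne']
      · simp [h]
    have e2 : (∏ l, if σ l < σ b then (-1 : ℤ) ^ c' l else 1) =
        ∏ j, if σ j < σ b then (-1 : ℤ) ^ c j else 1 := by
      refine Finset.prod_congr rfl fun j _ => ?_
      by_cases h : σ j < σ b
      · have : b ≠ j := fun e => by simp [e] at h
        simp [h, hcc, this]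
      · simp [h]
    rw [e1, e2] at key
    have e3 : (∏ m, if σ (w m) < σ b then (-1 : ℤ) else 1) =
        ∏ j, if σ j < σ b then (-1 : ℤ) ^ c j else 1 := by
      rw [prod_comp_word (fun j => if σ j < σ b then (-1 : ℤ) else 1) w]
      refine Finset.prod_congr rfl fun j _ => ?_
      split_ifs <;> simp [hc]
    rw [comp_cons, wordSign_cons, wordSign_cons', e3, wordSign_perm σ w]
    have sq : ∀ (p : Fin k → Prop) [DecidablePred p], (∏ j, if p j then (-1 : ℤ) ^ c j else 1) *
        (∏ j, if p j then (-1 : ℤ) ^ c j else 1) = 1 := by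
      intro p _
      rw [← Finset.prod_mul_distrib]
      refine Finset.prod_eq_one fun j _ => ?_
      split_ifs
      · rw [← mul_pow]; simp
      · simp
    have s1 := sq fun j => j < b
    have s2 := sq fun j => σ j < σ b
    -- Both products are signs, so with `L * L = 1` and `S * S = 1` the claim is a polynomial
    -- consequence of `key`.
    generalize (∏ j, if j < b then (-1 : ℤ) ^ c j else 1) = L at *
    generalize (∏ j, if σ j < σ b then (-1 : ℤ) ^ c j else 1) = S at *
    linear_combination wordSign w * L * S * key - wordSign w * S * koszulSign σ c * s1 +
      wordSign w * L * koszulSign σ c' * s2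

end Words

/-! ### Step surjections of words and pulled-back normalized simplices -/

section

open scoped Simplicial DoldKan

/-! ### The step functions of words -/

section Steps

variable {n : ℕ}

/-- The number of occurrences of `true` among the first `j` letters. -/
def stepCount (u : Fin n → Bool) (j : ℕ) : ℕ := ∑ l : Fin n, if (l : ℕ) < j ∧ u l then 1 else 0

theorem stepCount_mono (u : Fin n → Bool) {i j : ℕ} (h : i ≤ j) :
    stepCount u i ≤ stepCount u j := by
  refine Finset.sum_le_sum fun l _ => ?_
  by_cases h1 : (l : ℕ) < i ∧ u l
  · rw [if_pos h1, if_pos ⟨h1.1.trans_le h, h1.2⟩]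
  · simp [h1]

theorem stepCount_le (u : Fin n → Bool) (j : ℕ) : stepCount u j ≤ letterCount u := by
  refine Finset.sum_le_sum fun l _ => ?_
  by_cases h : u l <;> simp [h]
  split_ifs <;> simp

theorem stepCount_last (u : Fin n → Bool) : stepCount u n = letterCount u := by
  simp [stepCount, letterCount]

theorem stepCount_succ (u : Fin n → Bool) (i : Fin n) :
    stepCount u (i + 1) = stepCount u i + if u i then 1 else 0 := by
  have h : ∀ l : Fin n, (if (l : ℕ) < i + 1 ∧ u l then 1 else 0) =
      (if (l : ℕ) < i ∧ u l then 1 else 0) + if l = i then (if u i then 1 else 0) else 0 := by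
    intro l
    rcases lt_trichotomy l i with h | rfl | h
    · have : (l : ℕ) < i + 1 := by have : (l : ℕ) < i := h; omega
      simp [h, h.ne, this]
    · simp
    · have h2 : ¬ (l : ℕ) < i + 1 := by have : (i : ℕ) < l := h; omega
      have h3 : ¬ (l : ℕ) < i := by omega
      simp [h.ne', h2, h3]
  rw [stepCount, Finset.sum_congr rfl fun l _ => h l, Finset.sum_add_distrib]
  simp [stepCount]

theorem stepCount_cons (b : Bool) (u : Fin n → Bool) (j : ℕ) :
    stepCount (Fin.cons b u : Fin (n + 1) → Bool) (j + 1) =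
      (if b then 1 else 0) + stepCount u j := by
  simp only [stepCount, Fin.sum_univ_succ, Fin.cons_zero, Fin.cons_succ]
  simp

/-- The surjection `[n] → [m]` of a word of length `n` with `m` letters `true`. -/
def stepHom (u : Fin n → Bool) : ⦋n⦌ ⟶ ⦋letterCount u⦌ :=
  SimplexCategory.mkHom
    { toFun := fun j => ⟨stepCount u j, Nat.lt_succ_of_le (stepCount_le u j)⟩
      monotone' := fun _ _ h => stepCount_mono u h }

@[simp]
theorem stepHom_val (u : Fin n → Bool) (j : Fin (n + 1)) :
    ((stepHom u).toOrderHom j : ℕ) = stepCount u j := rfl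

end Steps

variable {Q : Type u} [CommRing Q]

/-! ### Pulling back normalized simplices -/

section Pull

variable (A : SimplicialObject (ModuleCat.{u} Q)) {n m : ℕ}

/-- The component of degree `m` of an element is normalized and pulled back along `θ`. -/
def pull (θ : ⦋n⦌ ⟶ ⦋m⦌) : Tot (K[A]) →ₗ[Q] A.obj (op ⦋n⦌) :=
  (A.map θ.op).hom ∘ₗ ((DoldKan.PInfty : K[A] ⟶ K[A]).f m).hom ∘ₗ
    DirectSum.component Q ℕ (fun m => (K[A]).X m) m

/-- Letter counts of related words agree only propositionally. Since `pull` starts from the whole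
total module, the maps can be compared by values in `ℕ` without transport. -/
theorem pull_congr {m m' : ℕ} (h : m = m') (θ : ⦋n⦌ ⟶ ⦋m⦌) (θ' : ⦋n⦌ ⟶ ⦋m'⦌)
    (hθ : ∀ j, (θ.toOrderHom j : ℕ) = θ'.toOrderHom j) : pull A θ = pull A θ' := by
  subst h
  congr 1
  ext j : 3
  exact Fin.ext (hθ j)

theorem map_comp_pull {p : ℕ} (τ : ⦋p⦌ ⟶ ⦋n⦌) (θ : ⦋n⦌ ⟶ ⦋m⦌) :
    (A.map τ.op).hom ∘ₗ pull A θ = pull A (τ ≫ θ) := by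
  rw [pull, pull, op_comp, A.map_comp, ModuleCat.hom_comp]
  rfl

/-- Such a `θ` factors through the coface `δ v`, and `PInfty` takes values in the kernel of every
positive face. Vertex `0` is excluded because its face gives the differential. -/
theorem pull_eq_zero (θ : ⦋n⦌ ⟶ ⦋m⦌) (v : Fin (m + 1)) (hv : v ≠ 0)
    (hθ : ∀ j, θ.toOrderHom j ≠ v) : pull A θ = 0 := by
  obtain ⟨v, rfl⟩ := Fin.exists_succ_eq.2 hv
  rcases m with _ | m
  · exact v.elim0
  obtain ⟨θ', rfl⟩ := SimplexCategory.eq_comp_δ_of_not_surjective' θ v.succ hθ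
  have h : (DoldKan.PInfty : K[A] ⟶ K[A]).f (m + 1) ≫ A.δ v.succ = 0 := by
    rw [DoldKan.PInfty_f]
    exact DoldKan.HigherFacesVanish.of_P (m + 1) m v (by omega)
  refine LinearMap.ext fun x => ?_
  have h' := congrArg (fun f => f.hom (DirectSum.component Q ℕ (fun m => (K[A]).X m) (m + 1) x)) h
  change (A.map (θ' ≫ SimplexCategory.δ v.succ).op).hom _ = 0
  rw [op_comp, A.map_comp, ModuleCat.hom_comp, LinearMap.comp_apply]
  refine (congrArg (A.map θ'.op).hom h').trans ?_
  exact map_zero _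

theorem pull_lof (θ : ⦋n⦌ ⟶ ⦋m⦌) (x : A.obj (op ⦋m⦌)) :
    pull A θ (DirectSum.lof Q ℕ (fun m => (K[A]).X m) m x) =
      (A.map θ.op).hom (((DoldKan.PInfty : K[A] ⟶ K[A]).f m).hom x) := by
  rw [pull, LinearMap.comp_apply, LinearMap.comp_apply, DirectSum.component.lof_self]

theorem pull_lof_ne (θ : ⦋n⦌ ⟶ ⦋m⦌) {p : ℕ} (h : p ≠ m) (x : A.obj (op ⦋p⦌)) :
    pull A θ (DirectSum.lof Q ℕ (fun m => (K[A]).X m) p x) = 0 := by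
  rw [pull, LinearMap.comp_apply, LinearMap.comp_apply, DirectSum.component.of, dif_neg h]
  simp

/-- On the image of `PInfty` the alternating sum of faces reduces to face `0`, and `PInfty` commutes
with the differential. -/
theorem PInfty_comp_δ_zero (m : ℕ) : (DoldKan.PInfty : K[A] ⟶ K[A]).f (m + 1) ≫ A.δ 0 =
    (K[A]).d (m + 1) m ≫ (DoldKan.PInfty : K[A] ⟶ K[A]).f m := by
  rw [← (DoldKan.PInfty : K[A] ⟶ K[A]).comm, AlternatingFaceMapComplex.obj_d_eq,
    Fin.sum_univ_succ, Preadditive.comp_add, Preadditive.comp_sum, Finset.sum_eq_zero]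
  · simp
  · intro j _
    rw [Preadditive.comp_zsmul, DoldKan.PInfty_f,
      DoldKan.HigherFacesVanish.of_P (m + 1) m j (by omega), smul_zero]

theorem pull_comp_totD (θ : ⦋n⦌ ⟶ ⦋m⦌) :
    pull A θ ∘ₗ totD (K[A]) = pull A (θ ≫ SimplexCategory.δ 0) := by
  refine tot_ext fun p x => ?_
  rw [LinearMap.comp_apply, totD_lof]
  by_cases h : p = m + 1
  · subst h
    rw [pull_lof]
    have e := congrArg (fun f => (A.map θ.op).hom (f.hom x)) (PInfty_comp_δ_zero A m)
    refine (Eq.trans (pull_lof A θ _) e.symm).trans ?_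
    rw [op_comp, A.map_comp]
    rfl
  · refine Eq.trans ?_ (pull_lof_ne A _ h x).symm
    -- Degree `0` is separate because `totD` places its image in the component `0 - 1 = 0`, which
    -- may be the one read off; that image is zero by `shape`.
    rcases p with _ | p
    · rw [(K[A]).shape _ _ (by simp)]
      simp
    · exact pull_lof_ne A _ (fun e => h (by omega)) _

theorem pull_comp_totSign (θ : ⦋n⦌ ⟶ ⦋m⦌) :
    pull A θ ∘ₗ totSign (K[A]) = (-1 : Q) ^ m • pull A θ := by
  refine tot_ext fun p x => ?_
  rw [LinearMap.comp_apply, totSign_lof, map_smul, LinearMap.smul_apply]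
  by_cases h : p = m
  · subst h; rfl
  · rw [pull_lof_ne A θ h x, smul_zero, smul_zero]

theorem map_comp_pull_naturality {B : SimplicialObject (ModuleCat.{u} Q)} (f : A ⟶ B)
    (θ : ⦋n⦌ ⟶ ⦋m⦌) :
    (f.app (op ⦋n⦌)).hom ∘ₗ pull A θ =
      pull B θ ∘ₗ totMap (AlternatingFaceMapComplex.map f) := by
  refine tot_ext fun p x => ?_
  rw [LinearMap.comp_apply, LinearMap.comp_apply, totMap_lof]
  by_cases h : p = m
  · subst h
    refine Eq.trans ?_ (pull_lof B θ _).symm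
    rw [pull_lof, ← LinearMap.comp_apply, ← ModuleCat.hom_comp, f.naturality]
    refine congrArg (B.map θ.op).hom ?_
    exact (congrArg (fun f => f.hom x) (DoldKan.PInfty_f_naturality p f)).symm
  · rw [pull_lof_ne A θ h x, map_zero]
    exact (pull_lof_ne B θ h _).symm

theorem δ_comp_pull (θ : ⦋n + 1⦌ ⟶ ⦋m⦌) (j : Fin (n + 2)) :
    (A.δ j).hom ∘ₗ pull A θ = pull A (SimplexCategory.δ j ≫ θ) :=
  map_comp_pull A (SimplexCategory.δ j) θ

theorem δ_zero_comp_pull_cons_false (u : Fin n → Bool) :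
    (A.δ 0).hom ∘ₗ pull A (stepHom (Fin.cons false u : Fin (n + 1) → Bool)) =
      pull A (stepHom u) := by
  rw [δ_comp_pull]
  refine pull_congr A (by simp [letterCount_cons]) _ _ fun j => ?_
  change stepCount _ ((Fin.succAbove 0 j : Fin (n + 2)) : ℕ) = stepCount u j
  rw [Fin.succAbove_zero, Fin.val_succ, stepCount_cons]
  simp

/-- Omitting the first vertex leaves the step function of `u`, shifted up by one and so missing
vertex `0` of the target. That shift is the coface `δ 0`, hence a differential; for a first letter
`false` there is no shift. -/
theorem δ_zero_comp_pull_cons_true (u : Fin n → Bool) :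
    (A.δ 0).hom ∘ₗ pull A (stepHom (Fin.cons true u : Fin (n + 1) → Bool)) =
      pull A (stepHom u) ∘ₗ totD (K[A]) := by
  rw [δ_comp_pull, pull_comp_totD]
  refine pull_congr A (by simp [letterCount_cons, add_comm]) _ _ fun j => ?_
  change stepCount _ ((Fin.succAbove 0 j : Fin (n + 2)) : ℕ) =
    ((Fin.succAbove 0 ((stepHom u).toOrderHom j) : Fin (letterCount u + 2)) : ℕ)
  rw [Fin.succAbove_zero, Fin.val_succ, stepCount_cons, Fin.succAbove_zero, Fin.val_succ,
    stepHom_val]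
  simp [add_comm]

/-- When the last step goes up, only the last vertex reaches the top of the target, and the last
face omits it. -/
theorem δ_last_comp_pull (u : Fin (n + 1) → Bool) (h : u (Fin.last n)) :
    (A.δ (Fin.last (n + 1))).hom ∘ₗ pull A (stepHom u) = 0 := by
  rw [δ_comp_pull]
  have h1 := stepCount_succ u (Fin.last n)
  rw [if_pos h, Fin.val_last, stepCount_last] at h1
  refine pull_eq_zero A _ (Fin.last _) (fun e => ?_) fun j e => ?_
  · have := congrArg Fin.val e
    simp at this
    omega
  · have e' : stepCount u ((Fin.succAbove (Fin.last (n + 1)) j : Fin (n + 2)) : ℕ) =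
      letterCount u := congrArg Fin.val e
    rw [Fin.succAbove_last, Fin.val_castSucc] at e'
    have : stepCount u j ≤ stepCount u n := stepCount_mono u (Nat.lt_succ_iff.1 j.2)
    omega

theorem val_succAbove_castSucc_succ (i : Fin n) (j : Fin (n + 1)) :
    ((Fin.succAbove i.succ.castSucc j : Fin (n + 2)) : ℕ) =
      if (j : ℕ) ≤ i then (j : ℕ) else j + 1 := by
  simp only [Fin.succAbove, Fin.lt_def, Fin.val_castSucc, Fin.val_succ]
  split_ifs <;> first | rfl | (simp; omega)

/-- With steps up on both sides of vertex `i + 1`, its value is taken nowhere else and is positive,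
so omitting the vertex makes the composite miss it. -/
theorem δ_comp_pull_eq_zero (u : Fin (n + 1) → Bool) (i : Fin n) (h : u i.castSucc)
    (h' : u i.succ) : (A.δ i.succ.castSucc).hom ∘ₗ pull A (stepHom u) = 0 := by
  rw [δ_comp_pull]
  have h1 := stepCount_succ u i.castSucc
  have h2 := stepCount_succ u i.succ
  rw [if_pos h, Fin.val_castSucc] at h1
  rw [if_pos h', Fin.val_succ] at h2
  refine pull_eq_zero A _ ⟨stepCount u (i + 1), Nat.lt_succ_of_le (stepCount_le u _)⟩
    (fun e => ?_) fun j e => ?_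
  · have := congrArg Fin.val e
    simp at this
    omega
  · have e' : stepCount u ((Fin.succAbove i.succ.castSucc j : Fin (n + 2)) : ℕ) =
      stepCount u (i + 1) := congrArg Fin.val e
    rw [val_succAbove_castSucc_succ] at e'
    split_ifs at e' with h3
    · have := stepCount_mono u h3
      omega
    · have := stepCount_mono u (show (i : ℕ) + 1 + 1 ≤ j + 1 by omega)
      omega

theorem letterCount_comp_equiv (u : Fin n → Bool) (e : Equiv.Perm (Fin n)) :
    letterCount (u ∘ e) = letterCount u :=
  Equiv.sum_comp e fun l => if u l then 1 else 0

theorem stepCount_swap (u : Fin (n + 1) → Bool) (i : Fin n) (j : ℕ) (hj : j ≠ i + 1) :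
    stepCount (u ∘ Equiv.swap i.castSucc i.succ) j = stepCount u j := by
  rw [stepCount, stepCount,
    ← Equiv.sum_comp (Equiv.swap i.castSucc i.succ) fun l => if (l : ℕ) < j ∧ u l then 1 else 0]
  refine Finset.sum_congr rfl fun l _ => ?_
  have : ((Equiv.swap i.castSucc i.succ l : Fin (n + 1)) : ℕ) < j ↔ (l : ℕ) < j := by
    by_cases h1 : l = i.castSucc
    · subst h1
      rw [Equiv.swap_apply_left]
      simp only [Fin.val_succ, Fin.val_castSucc]
      omega
    · by_cases h2 : l = i.succ
      · subst h2
        rw [Equiv.swap_apply_right]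
        simp only [Fin.val_succ, Fin.val_castSucc]
        omega
      · rw [Equiv.swap_apply_of_ne_of_ne h1 h2]
  simp [this]

/-- Exchanging two neighbouring letters alters the step function only at the vertex between them,
which this face omits. -/
theorem δ_comp_pull_swap (u : Fin (n + 1) → Bool) (i : Fin n) :
    (A.δ i.succ.castSucc).hom ∘ₗ pull A (stepHom (u ∘ Equiv.swap i.castSucc i.succ)) =
      (A.δ i.succ.castSucc).hom ∘ₗ pull A (stepHom u) := by
  rw [δ_comp_pull, δ_comp_pull]
  refine pull_congr A (letterCount_comp_equiv _ _) _ _ fun j => ?_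
  refine stepCount_swap u i _ ?_
  change ((Fin.succAbove i.succ.castSucc j : Fin (n + 2)) : ℕ) ≠ _
  rw [val_succAbove_castSucc_succ]
  split_ifs <;> omega

end Pull

end

/-! ### The shuffle map, its equivariance, simplicial homotopies and the decalage -/

section

open scoped Simplicial DoldKan

variable {Q : Type u} [CommRing Q] {k : ℕ}

/-! ### Tensor products of simplicial modules -/

/-- The degreewise tensor product of a family of simplicial modules. -/
def tensorSimplicial (A : Fin k → SimplicialObject (ModuleCat.{u} Q)) :
    SimplicialObject (ModuleCat.{u} Q) where
  obj Δ := ModuleCat.of Q (⨂[Q] i, (A i).obj Δ)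
  map θ := ModuleCat.ofHom (PiTensorProduct.map fun i => ((A i).map θ).hom)
  map_id Δ := by
    refine ModuleCat.hom_ext ?_
    rw [ModuleCat.hom_ofHom]
    simp only [CategoryTheory.Functor.map_id, ModuleCat.hom_id]
    exact PiTensorProduct.map_id
  map_comp θ τ := by
    refine ModuleCat.hom_ext ?_
    rw [ModuleCat.hom_ofHom]
    simp only [Functor.map_comp, ModuleCat.hom_comp]
    exact PiTensorProduct.map_comp _ _

/-- The map of tensor products of simplicial modules induced by a family of maps. -/
def tensorSimplicialMap {A B : Fin k → SimplicialObject (ModuleCat.{u} Q)} (f : ∀ i, A i ⟶ B i) :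
    tensorSimplicial A ⟶ tensorSimplicial B where
  app Δ := ModuleCat.ofHom (PiTensorProduct.map fun i => ((f i).app Δ).hom)
  naturality Δ Δ' θ := by
    refine ModuleCat.hom_ext ?_
    change _ ∘ₗ _ = _ ∘ₗ _
    refine (PiTensorProduct.map_comp _ _).symm.trans (Eq.trans ?_ (PiTensorProduct.map_comp _ _))
    exact congrArg _ (funext fun i => congrArg ModuleCat.Hom.hom ((f i).naturality θ))

/-! ### The shuffle map -/

section Shuffle

variable (A : Fin k → SimplicialObject (ModuleCat.{u} Q))

/-- The term of the shuffle map that belongs to a word. -/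
def shuffleTerm {n : ℕ} (w : Fin n → Fin k) :
    TensorTot (fun i => K[A i]) →ₗ[Q] ⨂[Q] i, (A i).obj (op ⦋n⦌) :=
  PiTensorProduct.map fun i => pull (A i) (stepHom fun l => decide (w l = i))

/-- The shuffle map of a family of simplicial modules in degree `n`, on the tensor product of the
total modules. -/
def shuffleLin (n : ℕ) : TensorTot (fun i => K[A i]) →ₗ[Q] ⨂[Q] i, (A i).obj (op ⦋n⦌) :=
  ∑ w : Fin n → Fin k, (wordSign w : Q) • shuffleTerm A w

/-- A face map of the tensor product of simplicial modules. -/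
def tensorFace {n : ℕ} (j : Fin (n + 2)) :
    (⨂[Q] i, (A i).obj (op ⦋n + 1⦌)) →ₗ[Q] ⨂[Q] i, (A i).obj (op ⦋n⦌) :=
  PiTensorProduct.map fun i => ((A i).δ j).hom

theorem tensorFace_comp_shuffleTerm {n : ℕ} (j : Fin (n + 2)) (w : Fin (n + 1) → Fin k) :
    tensorFace A j ∘ₗ shuffleTerm A w = PiTensorProduct.map fun i =>
      ((A i).δ j).hom ∘ₗ pull (A i) (stepHom fun l => decide (w l = i)) :=
  (PiTensorProduct.map_comp _ _).symm

theorem tensorFace_comp_shuffleLin {n : ℕ} (j : Fin (n + 2)) :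
    tensorFace A j ∘ₗ shuffleLin A (n + 1) =
      ∑ w : Fin (n + 1) → Fin k, (wordSign w : Q) • (tensorFace A j ∘ₗ shuffleTerm A w) := by
  refine LinearMap.ext fun x => ?_
  simp [shuffleLin, LinearMap.sum_apply]

/-- The last face kills each term, in the slot of the last letter. An inner face kills terms with
equal letters on both sides of the omitted vertex; the other terms cancel in pairs, by exchanging
these letters. -/
theorem tensorFace_succ_comp_shuffleLin {n : ℕ} (j : Fin (n + 1)) :
    tensorFace A j.succ ∘ₗ shuffleLin A (n + 1) = 0 := by
  rw [tensorFace_comp_shuffleLin]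
  refine Fin.lastCases ?_ (fun i => ?_) j
  · refine Finset.sum_eq_zero fun w _ => ?_
    rw [tensorFace_comp_shuffleTerm, map_eq_zero_of_eq_zero (w (Fin.last n)), smul_zero]
    exact δ_last_comp_pull _ _ (by simp)
  · rw [Fin.succ_castSucc]
    have hz : ∀ w : Fin (n + 1) → Fin k, w i.castSucc = w i.succ →
        tensorFace A i.succ.castSucc ∘ₗ shuffleTerm A w = 0 := by
      intro w hw
      rw [tensorFace_comp_shuffleTerm, map_eq_zero_of_eq_zero (w i.succ)]
      exact δ_comp_pull_eq_zero _ _ i (by simp [hw]) (by simp)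
    refine Finset.sum_involution (fun w _ => w ∘ Equiv.swap i.castSucc i.succ) ?_ ?_
      (fun _ _ => Finset.mem_univ _) ?_
    · intro w _
      by_cases hw : w i.castSucc = w i.succ
      · rw [hz w hw, hz _ (by simp [hw]), smul_zero, smul_zero, add_zero]
      · have e : tensorFace A i.succ.castSucc ∘ₗ
            shuffleTerm A (w ∘ Equiv.swap i.castSucc i.succ) =
            tensorFace A i.succ.castSucc ∘ₗ shuffleTerm A w := by
          rw [tensorFace_comp_shuffleTerm, tensorFace_comp_shuffleTerm]
          exact congrArg _ (funext fun j =>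
            δ_comp_pull_swap (A j) (fun l => decide (w l = j)) i)
        rw [e, wordSign_swap w i hw, ← add_smul]
        simp
    · intro w _ hne e
      refine hne ?_
      rw [hz w, smul_zero]
      have := congrFun e i.castSucc
      simpa using this.symm
    · intro w _
      funext l
      simp

/-- Face `0` strips the first letter `b`: slot `b` acquires the differential, and the inversions of
`b` supply the signs in the slots before it. A word of length `n + 1` is thus a summand of the
tensor differential together with a word of length `n`. -/
theorem tensorFace_zero_comp_shuffleLin (n : ℕ) :
    tensorFace A 0 ∘ₗ shuffleLin A (n + 1) = shuffleLin A n ∘ₗ tensorD (fun i => K[A i]) := by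
  rw [tensorFace_comp_shuffleLin]
  have e1 : ∀ (b : Fin k) (w : Fin n → Fin k),
      (wordSign (Fin.cons b w : Fin (n + 1) → Fin k) : Q) •
        (tensorFace A 0 ∘ₗ shuffleTerm A (Fin.cons b w : Fin (n + 1) → Fin k)) =
      (wordSign w : Q) • (shuffleTerm A w ∘ₗ PiTensorProduct.map fun j =>
        if j < b then totSign (K[A j]) else if j = b then totD (K[A j]) else LinearMap.id) := by
    intro b w
    -- The sign is distributed over the slots; in a slot `j < b` the scalar `c j` acts as `totSign`,
    -- because `pull` sees only the degree equal to the letter count.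
    let c : Fin k → Q := fun j =>
      if j < b then (-1) ^ letterCount (fun l => decide (w l = j)) else 1
    have hs : (wordSign (Fin.cons b w : Fin (n + 1) → Fin k) : Q) =
        (wordSign w : Q) * ∏ j, c j := by
      rw [wordSign_cons', Int.cast_mul, mul_comm]
      congr 1
      push_cast
      refine Finset.prod_congr rfl fun j _ => ?_
      split_ifs <;> simp [c, *]
    rw [hs, mul_smul]
    congr 1
    rw [tensorFace_comp_shuffleTerm, ← map_smul_family, shuffleTerm, ← PiTensorProduct.map_comp]
    refine congrArg _ (funext fun j => ?_)
    rw [cons_decide]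
    by_cases hj : b = j
    · rw [decide_eq_true hj, δ_zero_comp_pull_cons_true]
      simp only [c, hj, lt_self_iff_false, if_false, if_true, one_smul]
    · rw [decide_eq_false hj, δ_zero_comp_pull_cons_false]
      by_cases h : j < b
      · simp only [c, if_pos h]
        exact (pull_comp_totSign _ _).symm
      · simp only [c, if_neg h, if_neg (Ne.symm hj), one_smul, LinearMap.comp_id]
  have e2 : shuffleLin A n ∘ₗ tensorD (fun i => K[A i]) =
      ∑ p : Fin k × (Fin n → Fin k), (wordSign p.2 : Q) • (shuffleTerm A p.2 ∘ₗ
        PiTensorProduct.map fun j => if j < p.1 then totSign (K[A j]) else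
          if j = p.1 then totD (K[A j]) else LinearMap.id) := by
    rw [Fintype.sum_prod_type_right]
    refine LinearMap.ext fun x => ?_
    simp only [shuffleLin, tensorD, LinearMap.comp_apply, LinearMap.sum_apply,
      LinearMap.smul_apply, map_sum]
    exact Finset.sum_comm
  rw [e2]
  refine (Fintype.sum_equiv (Fin.consEquiv fun _ => Fin k) _ _ fun p => ?_).symm
  exact (e1 p.1 p.2).symm

/-- The shuffle map in degree `n`. -/
def shuffleX (n : ℕ) : (tensorComplex fun i => K[A i]).X n ⟶ (K[tensorSimplicial A]).X n :=
  ModuleCat.ofHom (shuffleLin A n ∘ₗ (tensorDeg (fun i => K[A i]) n).subtype)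

theorem shuffleX_comm (n : ℕ) : shuffleX A (n + 1) ≫ (K[tensorSimplicial A]).d (n + 1) n =
    (tensorComplex fun i => K[A i]).d (n + 1) n ≫ shuffleX A n := by
  rw [AlternatingFaceMapComplex.obj_d_eq, Fin.sum_univ_succ, Preadditive.comp_add,
    Preadditive.comp_sum, Finset.sum_eq_zero, add_zero, tensorComplex_d]
  · refine ModuleCat.hom_ext (LinearMap.ext fun y => ?_)
    rw [Fin.val_zero, pow_zero, one_smul]
    exact LinearMap.congr_fun (tensorFace_zero_comp_shuffleLin A n) (Subtype.val y)
  · intro j _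
    have : shuffleX A (n + 1) ≫ (tensorSimplicial A).δ j.succ = 0 :=
      ModuleCat.hom_ext (LinearMap.ext fun y =>
        LinearMap.congr_fun (tensorFace_succ_comp_shuffleLin A j) (Subtype.val y))
    rw [Preadditive.comp_zsmul, this, smul_zero]

/-- The shuffle map `T(K[A 1], ..., K[A k]) ⟶ K[A 1 ⊗ ... ⊗ A k]`. -/
def shuffle : (tensorComplex fun i => K[A i]) ⟶ K[tensorSimplicial A] where
  f n := shuffleX A n
  comm' i j hij := by
    obtain rfl : j + 1 = i := hij
    exact shuffleX_comm A j

variable {A}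

theorem shuffleLin_naturality {B : Fin k → SimplicialObject (ModuleCat.{u} Q)}
    (f : ∀ i, A i ⟶ B i) (n : ℕ) :
    (PiTensorProduct.map fun i => ((f i).app (op ⦋n⦌)).hom) ∘ₗ shuffleLin A n =
      shuffleLin B n ∘ₗ PiTensorProduct.map fun i =>
        totMap (AlternatingFaceMapComplex.map (f i)) := by
  refine LinearMap.ext fun x => ?_
  simp only [shuffleLin, LinearMap.comp_apply, LinearMap.sum_apply, map_sum, LinearMap.smul_apply,
    map_smul]
  refine Finset.sum_congr rfl fun w _ => ?_
  congr 1
  rw [shuffleTerm, shuffleTerm, ← LinearMap.comp_apply, ← LinearMap.comp_apply,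
    ← PiTensorProduct.map_comp, ← PiTensorProduct.map_comp]
  exact LinearMap.congr_fun (congrArg _ (funext fun i => map_comp_pull_naturality _ _ _)) x

theorem map_gradedMap_eq_totMap {M N : ChainComplex (ModuleCat.{u} Q) ℕ} (f : M ⟶ N) :
    gradedMap 0 (fun n => (f.f n).hom) = totMap f :=
  tot_ext fun n x => by simp

theorem shuffle_naturality {B : Fin k → SimplicialObject (ModuleCat.{u} Q)}
    (f : ∀ i, A i ⟶ B i) :
    shuffle A ≫ AlternatingFaceMapComplex.map (tensorSimplicialMap f) =
      tensorMap (fun i => AlternatingFaceMapComplex.map (f i)) ≫ shuffle B := by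
  ext n : 1
  refine ModuleCat.hom_ext (LinearMap.ext fun y => ?_)
  exact LinearMap.congr_fun (shuffleLin_naturality f n) (Subtype.val y)

end Shuffle

/-! ### Equivariance of the shuffle map -/

section Equivariance

/-- On a homogeneous tensor of multidegree `a`, the sum over all words thus reduces to the shuffles
of type `a`. -/
theorem shuffleTerm_homTensor_eq_zero (A : SimplicialObject (ModuleCat.{u} Q)) {n : ℕ}
    (w : Fin n → Fin k) (a : Fin k → ℕ) (x : ∀ i, (K[A]).X (a i))
    (h : (fun j => letterCount (fun l => decide (w l = j))) ≠ a) :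
    shuffleTerm (fun _ => A) w (homTensor (K[A]) a x) = 0 := by
  obtain ⟨i, hi⟩ := Function.ne_iff.1 h
  rw [shuffleTerm, homTensor, PiTensorProduct.map_tprod]
  exact MultilinearMap.map_coord_zero _ i (pull_lof_ne A _ (Ne.symm hi) (x i))

/-- Permuting the factors matches the term of `w` with that of `σ ∘ w`. The ratio of their signs is
the Koszul sign of the letter counts, which equal the multidegree wherever the terms do not vanish.
-/
theorem permRep_comp_shuffleLin (A : SimplicialObject (ModuleCat.{u} Q)) (n : ℕ)
    (σ : Equiv.Perm (Fin k)) :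
    permRep Q k (A.obj (op ⦋n⦌)) σ ∘ₗ shuffleLin (fun _ => A) n =
      shuffleLin (fun _ => A) n ∘ₗ tPowAct k (K[A]) σ := by
  refine tPow_ext fun a x => ?_
  rw [LinearMap.comp_apply, LinearMap.comp_apply, tPowAct_homTensor, map_smul]
  simp only [shuffleLin, LinearMap.sum_apply, LinearMap.smul_apply, map_sum, map_smul,
    Finset.smul_sum]
  refine Fintype.sum_equiv (Equiv.arrowCongr (Equiv.refl (Fin n)) σ) _ _ fun w => ?_
  have hw : Equiv.arrowCongr (Equiv.refl (Fin n)) σ w = fun l => σ (w l) := rfl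
  rw [hw, wordSign_perm σ w]
  have hd : ∀ i, (fun l => decide (σ (w l) = i)) = fun l => decide (w l = σ.symm i) := by
    intro i
    funext l
    exact decide_eq_decide.2 (Equiv.eq_symm_apply σ).symm
  by_cases h : (fun j => letterCount (fun l => decide (w l = j))) = a
  · rw [h, Int.cast_mul, mul_comm, smul_smul, ← mul_assoc, ← Int.cast_mul]
    -- The Koszul sign is its own inverse, so the factor from `tPowAct` cancels the one from
    -- `wordSign_perm`.
    have hk : koszulSign σ a * koszulSign σ a = 1 := by
      simp only [koszulSign, ← Finset.prod_mul_distrib]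
      refine Finset.prod_eq_one fun i _ => Finset.prod_eq_one fun j _ => ?_
      split_ifs
      · rw [← mul_pow]; simp
      · simp
    rw [hk, Int.cast_one, one_mul]
    congr 1
    rw [shuffleTerm, shuffleTerm, homTensor, homTensor, PiTensorProduct.map_tprod,
      PiTensorProduct.map_tprod]
    refine (PiTensorProduct.reindex_tprod (R := Q) σ _).trans ?_
    exact congrArg _ (funext fun i => by rw [hd i])
  · rw [shuffleTerm_homTensor_eq_zero A w a x h, map_zero, smul_zero,
      shuffleTerm_homTensor_eq_zero, smul_zero, smul_zero]
    intro e
    refine h (funext fun j => ?_)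
    have := congrFun e (σ j)
    simpa [hd] using this

end Equivariance

/-! ### Homotopies between tensor products of simplicial maps -/

section SimplicialHomotopy

variable {A B : Fin k → SimplicialObject (ModuleCat.{u} Q)} {f g : ∀ i, A i ⟶ B i}

theorem map_hom_comp {V W X : Fin k → ModuleCat.{u} Q} (a : ∀ i, V i ⟶ W i) (b : ∀ i, W i ⟶ X i) :
    ModuleCat.ofHom (PiTensorProduct.map fun i => (a i).hom) ≫
        ModuleCat.ofHom (PiTensorProduct.map fun i => (b i).hom) =
      ModuleCat.ofHom (PiTensorProduct.map fun i => (a i ≫ b i).hom) :=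
  ModuleCat.hom_ext (PiTensorProduct.map_comp _ _).symm

/-- A family of simplicial homotopies induces a simplicial homotopy of tensor products. -/
def tensorSimplicialHomotopy (H : ∀ i, SimplicialObject.Homotopy (f i) (g i)) :
    SimplicialObject.Homotopy (tensorSimplicialMap f) (tensorSimplicialMap g) where
  -- Simplicial homotopy identities equate composites without sums, so all slots can be tensored at
  -- once, unlike for chain homotopies.
  h j := ModuleCat.ofHom (PiTensorProduct.map fun i => ((H i).h j).hom)
  h_zero_comp_δ_zero n := (map_hom_comp _ _).trans
    (by simp only [← SimplicialObject.δ_def, (H _).h_zero_comp_δ_zero]; rfl)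
  h_last_comp_δ_last n := (map_hom_comp _ _).trans
    (by simp only [← SimplicialObject.δ_def, (H _).h_last_comp_δ_last]; rfl)
  h_succ_comp_δ_castSucc_of_lt i j hij := (map_hom_comp _ _).trans (Eq.trans
    (by simp only [← SimplicialObject.δ_def, (H _).h_succ_comp_δ_castSucc_of_lt i j hij])
    (map_hom_comp _ _).symm)
  h_succ_comp_δ_castSucc_succ j := (map_hom_comp _ _).trans (Eq.trans
    (by simp only [← SimplicialObject.δ_def, (H _).h_succ_comp_δ_castSucc_succ j])
    (map_hom_comp _ _).symm)
  h_castSucc_comp_δ_succ_of_lt i j hij := (map_hom_comp _ _).trans (Eq.trans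
    (by simp only [← SimplicialObject.δ_def, (H _).h_castSucc_comp_δ_succ_of_lt i j hij])
    (map_hom_comp _ _).symm)
  h_comp_σ_castSucc_of_le i j hij := (map_hom_comp _ _).trans (Eq.trans
    (by simp only [← SimplicialObject.σ_def, (H _).h_comp_σ_castSucc_of_le i j hij])
    (map_hom_comp _ _).symm)
  h_comp_σ_succ_of_lt i j hij := (map_hom_comp _ _).trans (Eq.trans
    (by simp only [← SimplicialObject.σ_def, (H _).h_comp_σ_succ_of_lt i j hij])
    (map_hom_comp _ _).symm)

theorem tensorSimplicialMap_id (A : Fin k → SimplicialObject (ModuleCat.{u} Q)) :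
    tensorSimplicialMap (fun i => 𝟙 (A i)) = 𝟙 _ :=
  SimplicialObject.hom_ext _ _ fun _ => ModuleCat.hom_ext (PiTensorProduct.map_id (R := Q))

theorem tensorSimplicialMap_comp {C : Fin k → SimplicialObject (ModuleCat.{u} Q)}
    (f : ∀ i, A i ⟶ B i) (g : ∀ i, B i ⟶ C i) :
    tensorSimplicialMap (fun i => f i ≫ g i) = tensorSimplicialMap f ≫ tensorSimplicialMap g :=
  SimplicialObject.hom_ext _ _ fun Δ =>
    (map_hom_comp (fun i => (f i).app Δ) (fun i => (g i).app Δ)).symm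

end SimplicialHomotopy

/-! ### The decalage of a simplicial module -/

section Decalage

/-- The functor `[n] ↦ [n + 1]` that adds a new first vertex. -/
def coneFunctor : SimplexCategory ⥤ SimplexCategory where
  obj Δ := ⦋Δ.len + 1⦌
  map {Δ Δ'} θ := SimplexCategory.mkHom
    { toFun := fun j => Fin.cases 0 (fun l => (θ.toOrderHom l).succ) j
      monotone' := fun i j => by
        refine Fin.cases (fun _ => Fin.zero_le _) (fun i => ?_) i
        refine Fin.cases (fun h => absurd h (by simp)) (fun j h => ?_) j
        exact Fin.succ_le_succ_iff.2 (θ.toOrderHom.monotone (Fin.succ_le_succ_iff.1 h)) }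
  map_id Δ := by
    ext j : 3
    refine Fin.cases ?_ (fun l => ?_) j <;> rfl
  map_comp θ τ := by
    ext j : 3
    refine Fin.cases ?_ (fun l => ?_) j <;> rfl

theorem δ_toOrderHom_val {n : ℕ} (i : Fin (n + 2)) (m : Fin (n + 1)) :
    ((SimplexCategory.δ i).toOrderHom m : ℕ) = if (m : ℕ) < i then (m : ℕ) else m + 1 := by
  change ((Fin.succAbove i m : Fin (n + 2)) : ℕ) = _
  simp only [Fin.succAbove, Fin.lt_def, Fin.val_castSucc]
  split_ifs <;> simp

theorem σ_toOrderHom_val {n : ℕ} (i : Fin (n + 1)) (m : Fin (n + 2)) :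
    ((SimplexCategory.σ i).toOrderHom m : ℕ) = if (m : ℕ) ≤ i then (m : ℕ) else m - 1 := by
  change ((Fin.predAbove i m : Fin (n + 1)) : ℕ) = _
  simp only [Fin.predAbove, Fin.lt_def, Fin.val_castSucc]
  split_ifs <;> first | omega | simp

theorem coneFunctor_δ {n : ℕ} (i : Fin (n + 2)) :
    coneFunctor.map (SimplexCategory.δ i) = SimplexCategory.δ i.succ := by
  ext j : 3
  refine Fin.cases ?_ (fun l => ?_) j
  · exact (Fin.succ_succAbove_zero i).symm
  · exact (Fin.succ_succAbove_succ i l).symm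

theorem coneFunctor_σ {n : ℕ} (i : Fin (n + 1)) :
    coneFunctor.map (SimplexCategory.σ i) = SimplexCategory.σ i.succ := by
  ext j : 3
  refine Fin.cases ?_ (fun l => ?_) j
  · exact Fin.ext ((σ_toOrderHom_val i.succ 0).trans (if_pos (Nat.zero_le _))).symm
  · have key : ∀ l : Fin (n + 2), ((SimplexCategory.σ i).toOrderHom l : ℕ) + 1 =
        (SimplexCategory.σ i.succ).toOrderHom l.succ := by
      intro l
      rw [σ_toOrderHom_val, σ_toOrderHom_val]
      simp only [Fin.val_succ]
      split_ifs <;> omega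
    exact Fin.ext (key l)

/-- The inclusion of a simplex in its cone. -/
def coneInclusion : 𝟭 SimplexCategory ⟶ coneFunctor where
  app Δ := SimplexCategory.δ (n := Δ.len) 0
  naturality Δ Δ' θ := by
    ext j : 3
    rfl

/-- The vertex of the cone. -/
def coneVertex : (Functor.const SimplexCategory).obj ⦋0⦌ ⟶ coneFunctor where
  app Δ := SimplexCategory.const ⦋0⦌ ⦋Δ.len + 1⦌ 0
  naturality Δ Δ' θ := by
    ext j : 3
    rfl

/-- The projection of the cone to the point. -/
def coneToPoint : coneFunctor ⟶ (Functor.const SimplexCategory).obj ⦋0⦌ where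
  app Δ := SimplexCategory.const ⦋Δ.len + 1⦌ ⦋0⦌ 0
  naturality Δ Δ' θ := by
    ext j : 3
    rfl

variable (A : SimplicialObject (ModuleCat.{u} Q))

/-- The decalage of a simplicial module. -/
def decalage : SimplicialObject (ModuleCat.{u} Q) := coneFunctor.op ⋙ A

/-- The constant simplicial module of vertices. -/
def vertices : SimplicialObject (ModuleCat.{u} Q) :=
  ((Functor.const SimplexCategory).obj ⦋0⦌).op ⋙ A

/-- The face map `d_0`, as a map from the decalage. -/
def decalageProj : decalage A ⟶ A := Functor.whiskerRight (NatTrans.op coneInclusion) A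

/-- The first vertex, as a map from the decalage. -/
def decalageToVertices : decalage A ⟶ vertices A := Functor.whiskerRight (NatTrans.op coneVertex) A

/-- The degenerate simplices at the vertices, as a map to the decalage. -/
def verticesToDecalage : vertices A ⟶ decalage A := Functor.whiskerRight (NatTrans.op coneToPoint) A

theorem verticesToDecalage_comp : verticesToDecalage A ≫ decalageToVertices A = 𝟙 _ := by
  refine SimplicialObject.hom_ext _ _ fun Δ => ?_
  change A.map _ ≫ A.map _ = 𝟙 _
  rw [← A.map_comp, ← A.map_id]
  refine congrArg A.map (Quiver.Hom.unop_inj ?_)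
  ext j : 3
  exact Subsingleton.elim (α := Fin 1) _ _

/-- The map `[n + 2] → [n + 1]` that sends the first `i + 2` vertices to `0`. -/
def coneHomotopyHom {n : ℕ} (i : Fin (n + 1)) : ⦋n + 2⦌ ⟶ ⦋n + 1⦌ :=
  SimplexCategory.mkHom
    { toFun := fun m => ⟨if (m : ℕ) ≤ i + 1 then 0 else (m : ℕ) - 1, by split_ifs <;> omega⟩
      monotone' := fun a b h => by
        have h' : (a : ℕ) ≤ b := h
        simp only [Fin.mk_le_mk]
        split_ifs <;> omega }

theorem coneHomotopyHom_val {n : ℕ} (i : Fin (n + 1)) (m : Fin (n + 3)) :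
    ((coneHomotopyHom i).toOrderHom m : ℕ) = if (m : ℕ) ≤ i + 1 then 0 else (m : ℕ) - 1 := rfl

theorem hom_ext_val {n m : ℕ} {f g : ⦋n⦌ ⟶ ⦋m⦌}
    (h : ∀ j, (f.toOrderHom j : ℕ) = g.toOrderHom j) : f = g := by
  ext j : 3
  exact Fin.ext (h j)

theorem decalage_δ {n : ℕ} (i : Fin (n + 2)) :
    (decalage A).δ i = A.map (SimplexCategory.δ i.succ).op :=
  congrArg (fun f : ⦋n + 1⦌ ⟶ ⦋n + 2⦌ => A.map f.op) (coneFunctor_δ i)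

theorem decalage_σ {n : ℕ} (i : Fin (n + 1)) :
    (decalage A).σ i = A.map (SimplexCategory.σ i.succ).op :=
  congrArg (fun f : ⦋n + 2⦌ ⟶ ⦋n + 1⦌ => A.map f.op) (coneFunctor_σ i)

/-- The components of the contraction of the decalage. -/
def decalageContraction {n : ℕ} (i : Fin (n + 1)) :
    (decalage A).obj (op ⦋n⦌) ⟶ (decalage A).obj (op ⦋n + 1⦌) :=
  A.map (coneHomotopyHom i).op

/-- With the next three lemmas, this turns the identities of the contraction into equalities of
monotone maps, to be checked on values. The index is `i.succ` because the decalage discards face and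
degeneracy `0`. -/
theorem decalageContraction_comp_δ {n : ℕ} (j : Fin (n + 1)) (i : Fin (n + 2)) :
    decalageContraction A j ≫ (decalage A).δ i =
      A.map (SimplexCategory.δ i.succ ≫ coneHomotopyHom j).op :=
  (congrArg (fun t => decalageContraction A j ≫ t) (decalage_δ A i)).trans (A.map_comp _ _).symm

theorem δ_comp_decalageContraction {n : ℕ} (j : Fin (n + 1)) (i : Fin (n + 2)) :
    (decalage A).δ i ≫ decalageContraction A j =
      A.map (coneHomotopyHom j ≫ SimplexCategory.δ i.succ).op :=
  (congrArg (fun t => t ≫ decalageContraction A j) (decalage_δ A i)).trans (A.map_comp _ _).symm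

theorem decalageContraction_comp_σ {n : ℕ} (j : Fin (n + 1)) (i : Fin (n + 2)) :
    decalageContraction A j ≫ (decalage A).σ i =
      A.map (SimplexCategory.σ i.succ ≫ coneHomotopyHom j).op :=
  (congrArg (fun t => decalageContraction A j ≫ t) (decalage_σ A i)).trans (A.map_comp _ _).symm

theorem σ_comp_decalageContraction {n : ℕ} (j : Fin (n + 2)) (i : Fin (n + 1)) :
    (decalage A).σ i ≫ decalageContraction A j =
      A.map (coneHomotopyHom j ≫ SimplexCategory.σ i.succ).op :=
  (congrArg (fun t => t ≫ decalageContraction A j) (decalage_σ A i)).trans (A.map_comp _ _).symm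

theorem comp_toOrderHom_val {n m p : ℕ} (f : ⦋n⦌ ⟶ ⦋m⦌) (g : ⦋m⦌ ⟶ ⦋p⦌) (j : Fin (n + 1)) :
    ((f ≫ g).toOrderHom j : ℕ) = g.toOrderHom (f.toOrderHom j) := rfl

/-- The contraction of the decalage to the vertices. -/
def decalageHomotopy :
    SimplicialObject.Homotopy (decalageToVertices A ≫ verticesToDecalage A) (𝟙 (decalage A)) where
  h i := decalageContraction A i
  -- `coneHomotopyHom 0` is the degeneracy `σ 0`, and face `0` of the decalage is `δ 1`, a section
  -- of it.
  h_zero_comp_δ_zero n := by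
    refine (decalageContraction_comp_δ A _ _).trans (Eq.trans ?_ (A.map_id _))
    refine congrArg (fun f => A.map f.op) (hom_ext_val fun m => ?_)
    refine Eq.trans ?_ (show (m : ℕ) = _ from rfl)
    rw [comp_toOrderHom_val, coneHomotopyHom_val, δ_toOrderHom_val]
    have key : ∀ m : ℕ, (if (if m < 1 then m else m + 1) ≤ 0 + 1 then 0 else
        (if m < 1 then m else m + 1) - 1) = m := by
      intro m
      by_cases hm : m < 1
      · simp only [if_pos hm]
        split_ifs <;> omega
      · simp only [if_neg hm]
        split_ifs <;> omega
    exact key m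
  -- For the last index, `coneHomotopyHom` sends every vertex but the top one to `0`, and the last
  -- face omits the top one.
  h_last_comp_δ_last n := by
    refine (decalageContraction_comp_δ A _ _).trans (Eq.trans ?_ (A.map_comp _ _))
    refine congrArg (fun f => A.map f.op) (hom_ext_val fun m => ?_)
    refine Eq.trans (b := 0) ?_ rfl
    have hm : (m : ℕ) < n + 2 := m.2
    rw [comp_toOrderHom_val, coneHomotopyHom_val, δ_toOrderHom_val]
    simp only [Fin.val_succ, Fin.val_last]
    split_ifs <;> omega
  h_succ_comp_δ_castSucc_of_lt i j hij := by
    refine (decalageContraction_comp_δ A _ _).trans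
      (Eq.trans ?_ (δ_comp_decalageContraction A _ _).symm)
    refine congrArg (fun f => A.map f.op) (hom_ext_val fun m => ?_)
    have hij : (i : ℕ) ≤ j := hij
    rw [comp_toOrderHom_val, comp_toOrderHom_val, coneHomotopyHom_val, δ_toOrderHom_val,
      δ_toOrderHom_val, coneHomotopyHom_val]
    simp only [Fin.val_succ, Fin.val_castSucc]
    split_ifs <;> omega
  h_succ_comp_δ_castSucc_succ j := by
    refine (decalageContraction_comp_δ A _ _).trans
      (Eq.trans ?_ (decalageContraction_comp_δ A _ _).symm)
    refine congrArg (fun f => A.map f.op) (hom_ext_val fun m => ?_)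
    rw [comp_toOrderHom_val, comp_toOrderHom_val, coneHomotopyHom_val, δ_toOrderHom_val,
      coneHomotopyHom_val, δ_toOrderHom_val]
    simp only [Fin.val_succ, Fin.val_castSucc]
    split_ifs <;> omega
  h_castSucc_comp_δ_succ_of_lt i j hij := by
    refine (decalageContraction_comp_δ A _ _).trans
      (Eq.trans ?_ (δ_comp_decalageContraction A _ _).symm)
    refine congrArg (fun f => A.map f.op) (hom_ext_val fun m => ?_)
    have hij : (j : ℕ) < i := hij
    rw [comp_toOrderHom_val, comp_toOrderHom_val, coneHomotopyHom_val, δ_toOrderHom_val,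
      δ_toOrderHom_val, coneHomotopyHom_val]
    simp only [Fin.val_succ, Fin.val_castSucc]
    split_ifs <;> omega
  h_comp_σ_castSucc_of_le i j hij := by
    refine (decalageContraction_comp_σ A _ _).trans
      (Eq.trans ?_ (σ_comp_decalageContraction A _ _).symm)
    refine congrArg (fun f => A.map f.op) (hom_ext_val fun m => ?_)
    have hij : (i : ℕ) ≤ j := hij
    rw [comp_toOrderHom_val, comp_toOrderHom_val, coneHomotopyHom_val, σ_toOrderHom_val,
      σ_toOrderHom_val, coneHomotopyHom_val]
    simp only [Fin.val_succ, Fin.val_castSucc]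
    split_ifs <;> omega
  h_comp_σ_succ_of_lt i j hij := by
    refine (decalageContraction_comp_σ A _ _).trans
      (Eq.trans ?_ (σ_comp_decalageContraction A _ _).symm)
    refine congrArg (fun f => A.map f.op) (hom_ext_val fun m => ?_)
    have hij : (j : ℕ) ≤ i := hij
    rw [comp_toOrderHom_val, comp_toOrderHom_val, coneHomotopyHom_val, σ_toOrderHom_val,
      σ_toOrderHom_val, coneHomotopyHom_val]
    simp only [Fin.val_succ, Fin.val_castSucc]
    split_ifs <;> omega

/-- The linear section of `decalageProj` given by the degeneracy `s_0`. -/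
def decalageSection (Δ : SimplexCategoryᵒᵖ) : A.obj Δ ⟶ (decalage A).obj Δ :=
  A.map (SimplexCategory.σ (n := Δ.unop.len) 0).op

/-- This is `d_0 s_0 = 1`. The section is in general not simplicial, so the sequence splits only
degreewise; tensor products are degreewise too, so this suffices for exactness after tensoring. -/
theorem decalageSection_comp (Δ : SimplexCategoryᵒᵖ) :
    decalageSection A Δ ≫ (decalageProj A).app Δ = 𝟙 _ := by
  change A.map (SimplexCategory.σ (n := Δ.unop.len) 0).op ≫
    A.map (SimplexCategory.δ (n := Δ.unop.len) 0).op = 𝟙 _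
  rw [← A.map_comp, ← op_comp]
  have := SimplexCategory.δ_comp_σ_self (i := (0 : Fin (Δ.unop.len + 1)))
  rw [Fin.castSucc_zero] at this
  rw [this]
  exact A.map_id _

/-- The degreewise kernel of a map of simplicial modules. -/
def kernelSimplicial {A B : SimplicialObject (ModuleCat.{u} Q)} (f : A ⟶ B) :
    SimplicialObject (ModuleCat.{u} Q) where
  obj Δ := ModuleCat.of Q (LinearMap.ker (f.app Δ).hom)
  map {Δ Δ'} θ := ModuleCat.ofHom ((A.map θ).hom.restrict fun x hx => by
    have h := congrArg (fun g => g.hom x) (f.naturality θ)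
    simp only [ModuleCat.hom_comp, LinearMap.comp_apply] at h
    rw [LinearMap.mem_ker] at hx ⊢
    rw [h, hx, map_zero])
  map_id Δ := by
    refine ModuleCat.hom_ext (LinearMap.ext fun x => Subtype.ext ?_)
    exact congrArg (fun g => g.hom (Subtype.val x)) (A.map_id Δ)
  map_comp θ τ := by
    refine ModuleCat.hom_ext (LinearMap.ext fun x => Subtype.ext ?_)
    exact congrArg (fun g => g.hom (Subtype.val x)) (A.map_comp θ τ)

/-- The inclusion of the degreewise kernel. -/
def kernelInclusion {A B : SimplicialObject (ModuleCat.{u} Q)} (f : A ⟶ B) :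
    kernelSimplicial f ⟶ A where
  app Δ := ModuleCat.ofHom (LinearMap.ker (f.app Δ).hom).subtype
  naturality _ _ _ := rfl

theorem decalageProj_section_apply (Δ : SimplexCategoryᵒᵖ) (x : A.obj Δ) :
    ((decalageProj A).app Δ).hom ((decalageSection A Δ).hom x) = x :=
  congrArg (fun g => g.hom x) (decalageSection_comp A Δ)

/-- The linear retraction to the kernel of `decalageProj`. -/
def decalageRetraction (Δ : SimplexCategoryᵒᵖ) :
    (decalage A).obj Δ ⟶ (kernelSimplicial (decalageProj A)).obj Δ :=
  ModuleCat.ofHom (LinearMap.codRestrict (LinearMap.ker ((decalageProj A).app Δ).hom)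
    (LinearMap.id - (decalageSection A Δ).hom ∘ₗ ((decalageProj A).app Δ).hom) fun x => by
      refine LinearMap.mem_ker.2 ((map_sub ((decalageProj A).app Δ).hom x _).trans
        (sub_eq_zero.2 ?_))
      exact (decalageProj_section_apply A Δ _).symm)

end Decalage

end

section

variable {Q : Type u} [CommRing Q]

/-! ### The decalage in one slot -/

section OneSlot

variable (A : SimplicialObject (ModuleCat.{u} Q))

/-- The decalage of `A` if `b` holds, and `A` otherwise. -/
def decalageIf (A : SimplicialObject (ModuleCat.{u} Q)) : Bool → SimplicialObject (ModuleCat.{u} Q)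
  | true => decalage A
  | false => A

/-- The kernel of the projection of the decalage if `b` holds, and `A` otherwise. -/
def kernelIf (A : SimplicialObject (ModuleCat.{u} Q)) : Bool → SimplicialObject (ModuleCat.{u} Q)
  | true => kernelSimplicial (decalageProj A)
  | false => A

/-- The vertices of `A` if `b` holds, and `A` otherwise. -/
def verticesIf (A : SimplicialObject (ModuleCat.{u} Q)) : Bool → SimplicialObject (ModuleCat.{u} Q)
  | true => vertices A
  | false => A

/-- The inclusion of the kernel in the decalage. -/
def inclusionIf : ∀ b, kernelIf A b ⟶ decalageIf A b
  | true => kernelInclusion _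
  | false => 𝟙 A

/-- The projection of the decalage. -/
def projIf : ∀ b, decalageIf A b ⟶ A
  | true => decalageProj A
  | false => 𝟙 A

/-- The retraction to the kernel. -/
def retractionIf : ∀ b Δ, (decalageIf A b).obj Δ ⟶ (kernelIf A b).obj Δ
  | true, Δ => decalageRetraction A Δ
  | false, Δ => 𝟙 (A.obj Δ)

/-- The section of the projection. -/
def sectionIf : ∀ b Δ, A.obj Δ ⟶ (decalageIf A b).obj Δ
  | true, Δ => decalageSection A Δ
  | false, Δ => 𝟙 (A.obj Δ)

/-- The map to the vertices. -/
def toVerticesIf : ∀ b, decalageIf A b ⟶ verticesIf A b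
  | true => decalageToVertices A
  | false => 𝟙 A

/-- The map from the vertices. -/
def fromVerticesIf : ∀ b, verticesIf A b ⟶ decalageIf A b
  | true => verticesToDecalage A
  | false => 𝟙 A

theorem fromVerticesIf_comp : ∀ b, fromVerticesIf A b ≫ toVerticesIf A b = 𝟙 _
  | true => verticesToDecalage_comp A
  | false => Category.comp_id (𝟙 A)

/-- The deformation retraction to the vertices. -/
def homotopyIf : ∀ b, SimplicialObject.Homotopy (toVerticesIf A b ≫ fromVerticesIf A b) (𝟙 _)
  | true => decalageHomotopy A
  | false => by
    change SimplicialObject.Homotopy (𝟙 A ≫ 𝟙 A) (𝟙 A)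
    rw [Category.comp_id]
    exact SimplicialObject.Homotopy.refl _

theorem inclusionIf_retractionIf (b : Bool) (Δ : SimplexCategoryᵒᵖ) :
    (inclusionIf A b).app Δ ≫ retractionIf A b Δ = 𝟙 _ := by
  cases b
  · exact Category.comp_id (𝟙 (A.obj Δ))
  · refine ModuleCat.hom_ext (LinearMap.ext fun x => Subtype.ext ?_)
    change Subtype.val x - (decalageSection A Δ).hom
      (((decalageProj A).app Δ).hom (Subtype.val x)) = Subtype.val x
    have hx : ((decalageProj A).app Δ).hom (Subtype.val x) = 0 := x.2
    rw [hx, map_zero]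
    exact sub_zero _

theorem sectionIf_projIf (b : Bool) (Δ : SimplexCategoryᵒᵖ) :
    sectionIf A b Δ ≫ (projIf A b).app Δ = 𝟙 _ := by
  cases b
  · exact Category.comp_id (𝟙 (A.obj Δ))
  · exact decalageSection_comp A Δ

/-- Restricted to `true`: for `false` both maps are identities. `SlotSplitting` records the same
distinction between slot `l` and the others. -/
theorem inclusionIf_projIf : inclusionIf A true ≫ projIf A true = 0 := by
  refine SimplicialObject.hom_ext _ _ fun Δ => ModuleCat.hom_ext (LinearMap.ext fun x => ?_)
  exact x.2

theorem retractionIf_add (Δ : SimplexCategoryᵒᵖ) :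
    retractionIf A true Δ ≫ (inclusionIf A true).app Δ +
      (projIf A true).app Δ ≫ sectionIf A true Δ = 𝟙 _ := by
  refine ModuleCat.hom_ext (LinearMap.ext fun x => ?_)
  exact sub_add_cancel x _

end OneSlot

end

/-! ### Quasi-isomorphism of the shuffle map and passage to exterior powers -/

section

open scoped Simplicial DoldKan

variable {Q : Type u} [CommRing Q] {k : ℕ}

/-! ### Chain maps that are isomorphisms on homology in a range -/

section Range

variable {K L : ChainComplex (ModuleCat.{u} Q) ℕ}

/-- A chain map that is surjective on homology in degrees `< n` and injective on homology in
degrees `< n - 1`. -/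
def IsoBelow (f : K ⟶ L) (n : ℕ) : Prop :=
  (∀ i < n, Epi (HomologicalComplex.homologyMap f i)) ∧
    ∀ i, i + 1 < n → Mono (HomologicalComplex.homologyMap f i)

theorem quasiIso_of_isoBelow {f : K ⟶ L} (h : ∀ n, IsoBelow f n) : QuasiIso f := by
  rw [quasiIso_iff]
  intro i
  rw [quasiIsoAt_iff_isIso_homologyMap]
  have := (h (i + 1)).1 i (Nat.lt_succ_self i)
  have := (h (i + 2)).2 i (Nat.lt_succ_self _)
  exact isIso_of_mono_of_epi _

/-- The four lemmas on the long exact sequence, with the middle map invertible on homology. Epi in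
degree `i` for the third map needs epi in degree `i - 1` for the first; mono in degree `i` needs epi
in degree `i` and mono in degree `i - 1`. The offset in `IsoBelow` is the one this step preserves.
-/
theorem IsoBelow.succ {S T : ShortComplex (ChainComplex (ModuleCat.{u} Q) ℕ)} (φ : S ⟶ T)
    (hS : S.ShortExact) (hT : T.ShortExact) {n : ℕ} (h₁ : IsoBelow φ.τ₁ n)
    (h₂ : QuasiIso φ.τ₂) : IsoBelow φ.τ₃ (n + 1) := by
  refine ⟨fun i hi => ?_, fun i hi => ?_⟩
  · refine HomologicalComplex.HomologySequence.epi_homologyMap_τ₃ φ hS hT i inferInstance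
      (fun j hj => h₁.1 j ?_) (fun j _ => inferInstance)
    have : j + 1 = i := hj
    omega
  · refine HomologicalComplex.HomologySequence.mono_homologyMap_τ₃ φ hS hT i (h₁.1 i (by omega))
      inferInstance (fun j hj => h₁.2 j ?_)
    have : j + 1 = i := hj
    omega

end Range

/-! ### Short exact sequences in one slot -/

section Slot

variable {A B C : Fin k → SimplicialObject (ModuleCat.{u} Q)}

/-- Families of maps `f`, `g` that form a degreewise split short exact sequence in the slot `l` and
are isomorphisms in the other slots. -/
structure SlotSplitting (l : Fin k) (f : ∀ i, A i ⟶ B i) (g : ∀ i, B i ⟶ C i) where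
  /-- the retractions of `f` -/
  r : ∀ i Δ, (B i).obj Δ ⟶ (A i).obj Δ
  /-- the sections of `g` -/
  s : ∀ i Δ, (C i).obj Δ ⟶ (B i).obj Δ
  f_r : ∀ i Δ, (f i).app Δ ≫ r i Δ = 𝟙 _
  s_g : ∀ i Δ, s i Δ ≫ (g i).app Δ = 𝟙 _
  zero : f l ≫ g l = 0
  add : ∀ Δ, r l Δ ≫ (f l).app Δ + (g l).app Δ ≫ s l Δ = 𝟙 _
  r_f : ∀ i, i ≠ l → ∀ Δ, r i Δ ≫ (f i).app Δ = 𝟙 _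
  g_s : ∀ i, i ≠ l → ∀ Δ, (g i).app Δ ≫ s i Δ = 𝟙 _

variable {l : Fin k} {f : ∀ i, A i ⟶ B i} {g : ∀ i, B i ⟶ C i}

namespace SlotSplitting

variable (h : SlotSplitting l f g)

include h

theorem tensorMap_comp_eq_zero : tensorMap (fun i => AlternatingFaceMapComplex.map (f i)) ≫
    tensorMap (fun i => AlternatingFaceMapComplex.map (g i)) = 0 := by
  ext n : 1
  refine (tensorMapX_comp _ _ n).trans (tensorMapX_eq_zero l (funext fun m => ?_) n)
  exact congrArg (fun t => (t.app (op ⦋m⦌)).hom) h.zero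

theorem tensorSimplicialMap_comp_eq_zero :
    AlternatingFaceMapComplex.map (tensorSimplicialMap f) ≫
      AlternatingFaceMapComplex.map (tensorSimplicialMap g) = 0 := by
  ext n : 1
  refine (map_hom_comp (fun i => (f i).app (op ⦋n⦌)) (fun i => (g i).app (op ⦋n⦌))).trans ?_
  refine congrArg ModuleCat.ofHom (map_eq_zero_of_eq_zero l ?_)
  exact congrArg (fun t => (t.app (op ⦋n⦌)).hom) h.zero

/-- The short complex of tensor products of alternating face map complexes. -/
abbrev tensorShort : ShortComplex (ChainComplex (ModuleCat.{u} Q) ℕ) :=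
  ShortComplex.mk _ _ h.tensorMap_comp_eq_zero

/-- The short complex of alternating face map complexes of tensor products. -/
abbrev simplicialShort : ShortComplex (ChainComplex (ModuleCat.{u} Q) ℕ) :=
  ShortComplex.mk _ _ h.tensorSimplicialMap_comp_eq_zero

/-- The identity splits in slot `l` as `r f + g s` in diagrammatic order, while in the other slots
both composites are identities. Multilinearity in slot `l` then splits the tensor product. -/
theorem tensorShort_shortExact : h.tensorShort.ShortExact := by
  refine HomologicalComplex.shortExact_of_degreewise_shortExact _ fun n => ?_
  refine ShortComplex.Splitting.shortExact
    { r := tensorMapX (fun i m => (h.r i (op ⦋m⦌)).hom) n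
      s := tensorMapX (fun i m => (h.s i (op ⦋m⦌)).hom) n
      f_r := ?_
      s_g := ?_
      id := ?_ }
  · refine (tensorMapX_comp _ _ n).trans (Eq.trans ?_ (tensorMapX_id n))
    refine congrArg (fun φ => tensorMapX φ n) (funext fun i => funext fun m => ?_)
    exact congrArg ModuleCat.Hom.hom (h.f_r i (op ⦋m⦌))
  · refine (tensorMapX_comp _ _ n).trans (Eq.trans ?_ (tensorMapX_id n))
    refine congrArg (fun φ => tensorMapX φ n) (funext fun i => funext fun m => ?_)
    exact congrArg ModuleCat.Hom.hom (h.s_g i (op ⦋m⦌))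
  · refine Eq.trans ?_ (tensorMapX_id n)
    refine ((tensorMapX_eq_add l ?_ ?_ ?_ n).trans
      (congrArg₂ (· + ·) (tensorMapX_comp _ _ n).symm (tensorMapX_comp _ _ n).symm)).symm
    · exact funext fun m => (congrArg ModuleCat.Hom.hom (h.add (op ⦋m⦌))).symm
    · exact fun i hi => funext fun m => (congrArg ModuleCat.Hom.hom (h.r_f i hi (op ⦋m⦌))).symm
    · exact fun i hi => funext fun m => (congrArg ModuleCat.Hom.hom (h.g_s i hi (op ⦋m⦌))).symm

theorem simplicialShort_shortExact : h.simplicialShort.ShortExact := by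
  refine HomologicalComplex.shortExact_of_degreewise_shortExact _ fun n => ?_
  refine ShortComplex.Splitting.shortExact
    { r := ModuleCat.ofHom (PiTensorProduct.map fun i => (h.r i (op ⦋n⦌)).hom)
      s := ModuleCat.ofHom (PiTensorProduct.map fun i => (h.s i (op ⦋n⦌)).hom)
      f_r := ?_
      s_g := ?_
      id := ?_ }
  · refine (map_hom_comp (fun i => (f i).app (op ⦋n⦌)) _).trans
      (Eq.trans ?_ (ModuleCat.hom_ext (PiTensorProduct.map_id (R := Q))))
    exact congrArg (fun φ => ModuleCat.ofHom (PiTensorProduct.map φ))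
      (funext fun i => congrArg ModuleCat.Hom.hom (h.f_r i (op ⦋n⦌)))
  · refine (map_hom_comp _ (fun i => (g i).app (op ⦋n⦌))).trans
      (Eq.trans ?_ (ModuleCat.hom_ext (PiTensorProduct.map_id (R := Q))))
    exact congrArg (fun φ => ModuleCat.ofHom (PiTensorProduct.map φ))
      (funext fun i => congrArg ModuleCat.Hom.hom (h.s_g i (op ⦋n⦌)))
  · refine Eq.trans ?_ (ModuleCat.hom_ext (PiTensorProduct.map_id (R := Q)))
    refine Eq.trans (congrArg₂ (· + ·)
      (map_hom_comp (fun i => h.r i (op ⦋n⦌)) (fun i => (f i).app (op ⦋n⦌)))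
      (map_hom_comp (fun i => (g i).app (op ⦋n⦌)) (fun i => h.s i (op ⦋n⦌)))) ?_
    refine ModuleCat.hom_ext (map_eq_add_of_eq_off l ?_ ?_ ?_).symm
    · exact (congrArg ModuleCat.Hom.hom (h.add (op ⦋n⦌))).symm
    · exact fun i hi => (congrArg ModuleCat.Hom.hom (h.r_f i hi (op ⦋n⦌))).symm
    · exact fun i hi => (congrArg ModuleCat.Hom.hom (h.g_s i hi (op ⦋n⦌))).symm

theorem isoBelow_shuffle_succ {n : ℕ} (hA : IsoBelow (shuffle A) n)
    (hB : QuasiIso (shuffle B)) : IsoBelow (shuffle C) (n + 1) :=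
  IsoBelow.succ (S := h.tensorShort) (T := h.simplicialShort)
    { τ₁ := shuffle A
      τ₂ := shuffle B
      τ₃ := shuffle C
      comm₁₂ := shuffle_naturality f
      comm₂₃ := shuffle_naturality g }
    h.tensorShort_shortExact h.simplicialShort_shortExact hA hB

end SlotSplitting

end Slot

/-! ### Homotopy equivalences in every slot -/

section Equivalence

/-- A simplicial deformation retraction induces a homotopy equivalence of alternating face map
complexes. -/
def homotopyEquivOfRetraction {A B : SimplicialObject (ModuleCat.{u} Q)} (q : A ⟶ B) (j : B ⟶ A)
    (h : j ≫ q = 𝟙 B) (H : SimplicialObject.Homotopy (q ≫ j) (𝟙 A)) :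
    HomotopyEquiv (K[A]) (K[B]) where
  hom := AlternatingFaceMapComplex.map q
  inv := AlternatingFaceMapComplex.map j
  homotopyHomInvId := (Homotopy.ofEq ((alternatingFaceMapComplex _).map_comp q j).symm).trans
    (H.toChainHomotopy.trans (Homotopy.ofEq ((alternatingFaceMapComplex _).map_id A)))
  homotopyInvHomId := Homotopy.ofEq (((alternatingFaceMapComplex _).map_comp j q).symm.trans
    ((congrArg (alternatingFaceMapComplex _).map h).trans
      ((alternatingFaceMapComplex _).map_id B)))

variable {A B : Fin k → SimplicialObject (ModuleCat.{u} Q)} (q : ∀ i, A i ⟶ B i)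
  (j : ∀ i, B i ⟶ A i)

/-- Two-out-of-three in the naturality square: `q` induces homotopy equivalences both on the tensor
product of complexes and on the complex of the simplicial tensor product. -/
theorem quasiIso_shuffle_of_retraction (h : ∀ i, j i ≫ q i = 𝟙 (B i))
    (H : ∀ i, SimplicialObject.Homotopy (q i ≫ j i) (𝟙 (A i))) (hB : QuasiIso (shuffle B)) :
    QuasiIso (shuffle A) := by
  have h1 : QuasiIso (tensorMap fun i => AlternatingFaceMapComplex.map (q i)) :=
    quasiIso_tensorMap fun i => homotopyEquivOfRetraction (q i) (j i) (h i) (H i)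
  have H' := tensorSimplicialHomotopy H
  rw [tensorSimplicialMap_comp, tensorSimplicialMap_id] at H'
  have h' : tensorSimplicialMap j ≫ tensorSimplicialMap q = 𝟙 _ := by
    rw [← tensorSimplicialMap_comp, ← tensorSimplicialMap_id]
    exact congrArg tensorSimplicialMap (funext h)
  have h2 : QuasiIso (AlternatingFaceMapComplex.map (tensorSimplicialMap q)) :=
    (homotopyEquivOfRetraction _ _ h' H').quasiIso_hom
  have h3 : QuasiIso (shuffle A ≫ AlternatingFaceMapComplex.map (tensorSimplicialMap q)) := by
    rw [shuffle_naturality]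
    infer_instance
  exact quasiIso_of_comp_right _ (AlternatingFaceMapComplex.map (tensorSimplicialMap q))

end Equivalence

/-- The slotwise split exact sequence given by the decalage in the slot `l`. -/
def decalageSplitting (A : Fin k → SimplicialObject (ModuleCat.{u} Q)) (l : Fin k) :
    SlotSplitting l (fun i => inclusionIf (A i) (decide (i = l)))
      (fun i => projIf (A i) (decide (i = l))) where
  r i := retractionIf (A i) _
  s i := sectionIf (A i) _
  f_r i := inclusionIf_retractionIf (A i) _
  s_g i := sectionIf_projIf (A i) _
  zero := by
    rw [decide_eq_true rfl]
    exact inclusionIf_projIf (A l)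
  add Δ := by
    rw [decide_eq_true rfl]
    exact retractionIf_add (A l) Δ
  r_f i hi Δ := by
    rw [decide_eq_false hi]
    exact Category.comp_id (𝟙 ((A i).obj Δ))
  g_s i hi Δ := by
    rw [decide_eq_false hi]
    exact Category.comp_id (𝟙 ((A i).obj Δ))

/-! ### Constant simplicial modules -/

section Constant

/-- A simplicial module all of whose structure maps are isomorphisms. -/
def IsConstant (A : SimplicialObject (ModuleCat.{u} Q)) : Prop :=
  ∀ ⦃Δ Δ' : SimplexCategoryᵒᵖ⦄ (θ : Δ ⟶ Δ'), IsIso (A.map θ)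

theorem isConstant_vertices (A : SimplicialObject (ModuleCat.{u} Q)) : IsConstant (vertices A) :=
  fun Δ Δ' θ => by
    change IsIso (A.map (𝟙 (op ⦋0⦌)))
    infer_instance

theorem IsConstant.tensorSimplicial {A : Fin k → SimplicialObject (ModuleCat.{u} Q)}
    (h : ∀ i, IsConstant (A i)) : IsConstant (tensorSimplicial A) := fun Δ Δ' θ => by
  have := fun i => h i θ
  refine ⟨ModuleCat.ofHom (PiTensorProduct.map fun i => (inv ((A i).map θ)).hom),
    (map_hom_comp (fun i => (A i).map θ) (fun i => inv ((A i).map θ))).trans ?_,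
    (map_hom_comp (fun i => inv ((A i).map θ)) (fun i => (A i).map θ)).trans ?_⟩
  · simp only [IsIso.hom_inv_id]
    exact ModuleCat.hom_ext (PiTensorProduct.map_id (R := Q))
  · simp only [IsIso.inv_hom_id]
    exact ModuleCat.hom_ext (PiTensorProduct.map_id (R := Q))

instance mono_inclusionOfMooreComplexMap_f (A : SimplicialObject (ModuleCat.{u} Q)) (n : ℕ) :
    Mono ((inclusionOfMooreComplexMap A).f n) :=
  inferInstanceAs (Mono (Subobject.arrow _))

instance isIso_inclusionOfMooreComplexMap_f_zero (A : SimplicialObject (ModuleCat.{u} Q)) :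
    IsIso ((inclusionOfMooreComplexMap A).f 0) :=
  inferInstanceAs (IsIso (Subobject.arrow ⊤))

instance isIso_PInftyToNormalizedMooreComplex_f_zero (A : SimplicialObject (ModuleCat.{u} Q)) :
    IsIso ((DoldKan.PInftyToNormalizedMooreComplex A).f 0) := by
  have h : (DoldKan.PInftyToNormalizedMooreComplex A).f 0 ≫
      (inclusionOfMooreComplexMap A).f 0 = 𝟙 _ :=
    (HomologicalComplex.congr_hom
      (DoldKan.PInftyToNormalizedMooreComplex_comp_inclusionOfMooreComplexMap A) 0).trans
      (DoldKan.PInfty_f_0)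
  have : IsIso ((DoldKan.PInftyToNormalizedMooreComplex A).f 0 ≫
      (inclusionOfMooreComplexMap A).f 0) := by
    rw [h]
    infer_instance
  exact @IsIso.of_isIso_comp_right _ _ _ _ _ _ ((inclusionOfMooreComplexMap A).f 0)
    (isIso_inclusionOfMooreComplexMap_f_zero A) this

/-- Normalized simplices of positive degree are killed by `d_1`, which is invertible here. -/
theorem IsConstant.isZero_normalizedMooreComplex {A : SimplicialObject (ModuleCat.{u} Q)}
    (h : IsConstant A) (n : ℕ) : Limits.IsZero (((normalizedMooreComplex _).obj A).X (n + 1)) := by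
  have e := DoldKan.HigherFacesVanish.inclusionOfMooreComplexMap (X := A) n 0 (by simp)
  have := h (SimplexCategory.δ (n := n) (Fin.succ 0)).op
  have hz : (inclusionOfMooreComplexMap A).f (n + 1) = 0 :=
    (cancel_mono (A.map (SimplexCategory.δ (n := n) (Fin.succ 0)).op)).1
      (e.trans Limits.zero_comp.symm)
  exact Limits.IsZero.of_mono_eq_zero _ hz

instance quasiIso_PInftyToNormalizedMooreComplex (A : SimplicialObject (ModuleCat.{u} Q)) :
    QuasiIso (DoldKan.PInftyToNormalizedMooreComplex A) :=
  (DoldKan.homotopyEquivNormalizedMooreComplexAlternatingFaceMapComplex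
    (Y := A)).quasiIso_inv

theorem isZero_tensorComplex_X {M : Fin k → ChainComplex (ModuleCat.{u} Q) ℕ}
    (h : ∀ i n, Limits.IsZero ((M i).X (n + 1))) (n : ℕ) :
    Limits.IsZero ((tensorComplex M).X (n + 1)) := by
  have hz : tensorDeg M (n + 1) = ⊥ := by
    rw [tensorDeg, Submodule.span_eq_bot]
    rintro _ ⟨a, ha, x, rfl⟩
    obtain ⟨i, hi⟩ : ∃ i, a i ≠ 0 := by
      by_contra! hc
      simp [hc] at ha
    obtain ⟨m, hm⟩ := Nat.exists_eq_succ_of_ne_zero hi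
    have hM : Limits.IsZero ((M i).X (a i)) := hm ▸ h i m
    have := ModuleCat.subsingleton_of_isZero hM
    refine MultilinearMap.map_coord_zero _ i ?_
    rw [Subsingleton.elim (x i) 0, map_zero]
  have : Subsingleton (tensorDeg M (n + 1)) := hz ▸ inferInstance
  exact ModuleCat.isZero_of_subsingleton (ModuleCat.of Q (tensorDeg M (n + 1)))

/-- The empty word is the only word of length `0`, and `PInfty` is the identity in degree `0`. -/
theorem shuffleLin_zero_tprod (A : Fin k → SimplicialObject (ModuleCat.{u} Q))
    (x : ∀ i, (A i).obj (op ⦋0⦌)) :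
    shuffleLin A 0 (PiTensorProduct.tprod Q fun i =>
      DirectSum.lof Q ℕ (fun m => (K[A i]).X m) 0 (x i)) = PiTensorProduct.tprod Q x := by
  have hw : wordSign (Fin.elim0 : Fin 0 → Fin k) = 1 := by
    simp [wordSign]
  rw [shuffleLin, LinearMap.sum_apply, Fintype.sum_eq_single (Fin.elim0 : Fin 0 → Fin k)
    fun w hne => absurd (Subsingleton.elim _ _) hne, LinearMap.smul_apply, hw, Int.cast_one,
    one_smul, shuffleTerm, PiTensorProduct.map_tprod]
  refine congrArg _ (funext fun i => ?_)
  have hp : pull (A i) (stepHom fun l => decide ((Fin.elim0 l : Fin k) = i)) =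
      pull (A i) (𝟙 ⦋0⦌) :=
    pull_congr (A i) rfl _ _ fun j => by
      have : (j : ℕ) < 0 + 1 := j.2
      have hj : (j : ℕ) = 0 := by omega
      refine (stepHom_val _ _).trans (Eq.trans (Nat.le_zero.1 (stepCount_le _ _)) hj.symm)
  refine (LinearMap.congr_fun hp _).trans ((pull_lof (A i) (𝟙 _) (x i)).trans ?_)
  rw [DoldKan.PInfty_f_0, op_id, (A i).map_id]
  rfl

/-- The inverse, in degree `0`, of the shuffle map. -/
def tensorZeroInv {A : Fin k → SimplicialObject (ModuleCat.{u} Q)}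
    {M : Fin k → ChainComplex (ModuleCat.{u} Q) ℕ} (e : ∀ i, (A i).obj (op ⦋0⦌) ⟶ (M i).X 0) :
    (⨂[Q] i, (A i).obj (op ⦋0⦌)) →ₗ[Q] tensorDeg M 0 :=
  (PiTensorProduct.map fun i =>
    DirectSum.lof Q ℕ (fun m => (M i).X m) 0 ∘ₗ (e i).hom).codRestrict _ fun x => by
    induction x using PiTensorProduct.induction_on with
    | smul_tprod r x =>
      rw [map_smul, PiTensorProduct.map_tprod]
      exact Submodule.smul_mem _ _
        (Submodule.subset_span ⟨0, by simp, fun i => (e i).hom (x i), rfl⟩)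
    | add x y hx hy =>
      rw [map_add]
      exact Submodule.add_mem _ hx hy

theorem isIso_tensorMap_comp_shuffle_f_zero {A : Fin k → SimplicialObject (ModuleCat.{u} Q)}
    {M : Fin k → ChainComplex (ModuleCat.{u} Q) ℕ} (f : ∀ i, M i ⟶ K[A i])
    (hf : ∀ i, IsIso ((f i).f 0)) : IsIso ((tensorMap f ≫ shuffle A).f 0) := by
  let e : ∀ i, (A i).obj (op ⦋0⦌) ⟶ (M i).X 0 := fun i => inv ((f i).f 0)
  have key : ∀ x : ∀ i, (M i).X 0, shuffleLin A 0 (PiTensorProduct.map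
      (fun i => gradedMap 0 fun n => ((f i).f n).hom) (PiTensorProduct.tprod Q fun i =>
        DirectSum.lof Q ℕ (fun m => (M i).X m) 0 (x i))) =
      PiTensorProduct.tprod Q fun i => ((f i).f 0).hom (x i) := by
    intro x
    rw [PiTensorProduct.map_tprod]
    simp only [gradedMap_lof]
    exact shuffleLin_zero_tprod A fun i => ((f i).f 0).hom (x i)
  refine ⟨ModuleCat.ofHom (tensorZeroInv e), ?_, ?_⟩
  · refine ModuleCat.hom_ext (LinearMap.ext fun y => Subtype.ext ?_)
    refine LinearMap.eqOn_span
      (f := (PiTensorProduct.map fun i => DirectSum.lof Q ℕ (fun m => (M i).X m) 0 ∘ₗ (e i).hom) ∘ₗ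
        shuffleLin A 0 ∘ₗ PiTensorProduct.map (fun i => gradedMap 0 fun n => ((f i).f n).hom))
      (g := LinearMap.id) ?_ y.2
    rintro _ ⟨a, ha, x, rfl⟩
    obtain rfl : a = 0 := funext fun i => by simpa using (Finset.sum_eq_zero_iff.1 ha) i
    rw [LinearMap.comp_apply, LinearMap.comp_apply]
    refine (congrArg _ (key x)).trans ((PiTensorProduct.map_tprod _ _).trans ?_)
    refine congrArg _ (funext fun i => congrArg (DirectSum.lof Q ℕ (fun m => (M i).X m) 0) ?_)
    exact congrArg (fun t => t.hom (x i)) (IsIso.hom_inv_id ((f i).f 0))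
  · refine ModuleCat.hom_ext (PiTensorProduct.ext (MultilinearMap.ext fun x => ?_))
    refine Eq.trans (congrArg (fun t => shuffleLin A 0 (PiTensorProduct.map
      (fun i => gradedMap 0 fun n => ((f i).f n).hom) t)) (PiTensorProduct.map_tprod _ _)) ?_
    refine (key fun i => (e i).hom (x i)).trans ?_
    refine congrArg _ (funext fun i => ?_)
    exact congrArg (fun t => t.hom (x i)) (IsIso.inv_hom_id ((f i).f 0))

/-- Passing to normalized Moore complexes on both sides, by homotopy equivalences, leaves complexes
concentrated in degree `0`. The shuffle map becomes an isomorphism `c` between them. -/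
theorem quasiIso_shuffle_of_isConstant {A : Fin k → SimplicialObject (ModuleCat.{u} Q)}
    (h : ∀ i, IsConstant (A i)) : QuasiIso (shuffle A) := by
  have h1 : QuasiIso (tensorMap fun i => inclusionOfMooreComplexMap (A i)) :=
    quasiIso_tensorMap fun i => DoldKan.homotopyEquivNormalizedMooreComplexAlternatingFaceMapComplex
      (Y := A i)
  let c := (tensorMap (fun i => inclusionOfMooreComplexMap (A i)) ≫ shuffle A) ≫
    DoldKan.PInftyToNormalizedMooreComplex (tensorSimplicial A)
  have hc : ∀ n, IsIso (c.f n) := by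
    rintro (_ | n)
    · have := isIso_tensorMap_comp_shuffle_f_zero (fun i => inclusionOfMooreComplexMap (A i))
        fun i => inferInstance
      rw [HomologicalComplex.comp_f]
      infer_instance
    · have z1 := isZero_tensorComplex_X (fun i => (h i).isZero_normalizedMooreComplex) n
      have z2 := (IsConstant.tensorSimplicial h).isZero_normalizedMooreComplex n
      exact ⟨0, z1.eq_of_src _ _, z2.eq_of_src _ _⟩
  have : IsIso c := HomologicalComplex.Hom.isIso_of_components c
  have h2 : QuasiIso c := inferInstance
  have h3 : QuasiIso (tensorMap (fun i => inclusionOfMooreComplexMap (A i)) ≫ shuffle A) :=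
    quasiIso_of_comp_right _ (DoldKan.PInftyToNormalizedMooreComplex (tensorSimplicial A))
  exact quasiIso_of_comp_left (tensorMap fun i => inclusionOfMooreComplexMap (A i)) _

end Constant

/-! ### The shuffle map is a quasi-isomorphism -/

/-- Here `S` contains the slots allowed to be nonconstant. For a new slot `l`, the decalage in that
slot retracts to a family constant there, which the induction on `S` covers. The kernel of its
projection may again be nonconstant only in the same slots, so an inner induction on degree
concludes. -/
theorem quasiIso_shuffle_of_isConstant_off (S : Finset (Fin k)) :
    ∀ A : Fin k → SimplicialObject (ModuleCat.{u} Q), (∀ i ∉ S, IsConstant (A i)) →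
      QuasiIso (shuffle A) := by
  induction S using Finset.induction_on with
  | empty => exact fun A h => quasiIso_shuffle_of_isConstant fun i => h i (by simp)
  | insert l S _ ih =>
    have dec : ∀ A : Fin k → SimplicialObject (ModuleCat.{u} Q),
        (∀ i ∉ insert l S, IsConstant (A i)) →
        QuasiIso (shuffle fun i => decalageIf (A i) (decide (i = l))) := by
      intro A h
      refine quasiIso_shuffle_of_retraction (fun i => toVerticesIf (A i) (decide (i = l)))
        (fun i => fromVerticesIf (A i) (decide (i = l))) (fun i => fromVerticesIf_comp _ _)
        (fun i => homotopyIf _ _) (ih _ fun i hi => ?_)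
      by_cases e : i = l
      · rw [decide_eq_true e]
        exact isConstant_vertices (A i)
      · rw [decide_eq_false e]
        exact h i (by simp [e, hi])
    -- All families are treated at once, because the step for `A` uses the hypothesis for the family
    -- with the kernel in slot `l`.
    have main : ∀ n, ∀ A : Fin k → SimplicialObject (ModuleCat.{u} Q),
        (∀ i ∉ insert l S, IsConstant (A i)) → IsoBelow (shuffle A) n := by
      intro n
      induction n with
      | zero => exact fun A _ => ⟨fun i hi => by omega, fun i hi => by omega⟩
      | succ n hn =>
        intro A h
        refine (decalageSplitting A l).isoBelow_shuffle_succ (hn _ fun i hi => ?_) (dec A h)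
        have e : i ≠ l := fun e => hi (by simp [e])
        rw [decide_eq_false e]
        exact h i hi
    exact fun A h => quasiIso_of_isoBelow fun n => main n A h

/-- The shuffle map is a quasi-isomorphism. -/
theorem quasiIso_shuffle (A : Fin k → SimplicialObject (ModuleCat.{u} Q)) :
    QuasiIso (shuffle A) :=
  quasiIso_shuffle_of_isConstant_off Finset.univ A fun i hi => absurd (Finset.mem_univ i) hi

/-! ### Antisymmetrization -/

section Antisymmetrize

variable {V W : Type u} [AddCommGroup V] [Module Q V] [AddCommGroup W] [Module Q W]

/-- The operator `c • ∑ σ, sign σ • σ`, which for `c = 1 / k!` is a projection to the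
sign-isotypic part. -/
def antisymmetrize (c : Q) (ρ : Representation Q (Equiv.Perm (Fin k)) V) : V →ₗ[Q] V :=
  c • ∑ σ : Equiv.Perm (Fin k), (((Equiv.Perm.sign σ : ℤˣ) : ℤ) : Q) • ρ σ

variable (c : Q) (ρ : Representation Q (Equiv.Perm (Fin k)) V)
  (ρ' : Representation Q (Equiv.Perm (Fin k)) W)

theorem antisymmetrize_apply (y : V) : antisymmetrize c ρ y =
    c • ∑ σ : Equiv.Perm (Fin k), (((Equiv.Perm.sign σ : ℤˣ) : ℤ) : Q) • ρ σ y := by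
  simp [antisymmetrize, LinearMap.sum_apply]

theorem sign_mul_sign_cast (σ : Equiv.Perm (Fin k)) :
    (((Equiv.Perm.sign σ : ℤˣ) : ℤ) : Q) * (((Equiv.Perm.sign σ : ℤˣ) : ℤ) : Q) = 1 := by
  rw [← Int.cast_mul, ← Units.val_mul, Int.units_mul_self, Units.val_one, Int.cast_one]

/-- Left translation by `τ` permutes the summands and multiplies each by its sign. This holds for
every `c`; the value `1 / k!` matters only for fixing the sign part. -/
theorem antisymmetrize_mem (y : V) : antisymmetrize c ρ y ∈ signPart ρ := by
  intro τ
  have h : ∀ σ : Equiv.Perm (Fin k), ρ τ ((((Equiv.Perm.sign σ : ℤˣ) : ℤ) : Q) • ρ σ y) =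
      (((Equiv.Perm.sign τ : ℤˣ) : ℤ) : Q) •
        ((((Equiv.Perm.sign (τ * σ) : ℤˣ) : ℤ) : Q) • ρ (τ * σ) y) := by
    intro σ
    rw [(ρ τ).map_smul, map_mul, map_mul ρ, Units.val_mul, Int.cast_mul, smul_smul,
      ← mul_assoc, sign_mul_sign_cast, one_mul]
    rfl
  rw [antisymmetrize_apply, (ρ τ).map_smul, smul_comm, map_sum,
    Finset.sum_congr rfl fun σ _ => h σ, ← Finset.smul_sum]
  rw [Fintype.sum_equiv (Equiv.mulLeft τ) (fun σ => (((Equiv.Perm.sign (τ * σ) : ℤˣ) : ℤ) : Q) •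
    ρ (τ * σ) y) (fun σ => (((Equiv.Perm.sign σ : ℤˣ) : ℤ) : Q) • ρ σ y) fun σ => rfl]

theorem antisymmetrize_of_mem (hc : c * ((k.factorial : ℕ) : Q) = 1) {y : V}
    (hy : y ∈ signPart ρ) : antisymmetrize c ρ y = y := by
  have h : ∀ σ : Equiv.Perm (Fin k), (((Equiv.Perm.sign σ : ℤˣ) : ℤ) : Q) • ρ σ y = y := by
    intro σ
    rw [hy σ, smul_smul, sign_mul_sign_cast, one_smul]
  rw [antisymmetrize_apply, Finset.sum_congr rfl fun σ _ => h σ, Finset.sum_const,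
    Finset.card_univ, Fintype.card_perm, Fintype.card_fin, ← Nat.cast_smul_eq_nsmul Q, smul_smul,
    hc, one_smul]

variable {ρ ρ'}

theorem map_antisymmetrize (f : V →ₗ[Q] W) (h : ∀ σ y, f (ρ σ y) = ρ' σ (f y)) (y : V) :
    f (antisymmetrize c ρ y) = antisymmetrize c ρ' (f y) := by
  simp only [antisymmetrize_apply, map_smul, map_sum, h]

end Antisymmetrize

/-! ### Exterior powers as retracts of tensor powers -/

section Retract

variable (k)

/-- The inclusion of the exterior power of a complex in the tensor power. -/
def extInclusion (M : ChainComplex (ModuleCat.{u} Q) ℕ) :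
    extPowerObj k M ⟶ tensorComplex fun _ : Fin k => M where
  f n := ModuleCat.ofHom (Submodule.inclusion (inf_le_left : extDeg k M n ≤ tPowDeg k M n))
  comm' i j hij := by
    obtain rfl : j + 1 = i := hij
    have h : (extPowerObj k M).d (j + 1) j = ModuleCat.ofHom ((tPowD k M).restrict
        (p := extDeg k M (j + 1)) (q := extDeg k M j) fun _ hy => tPowD_mem_extDeg M hy) :=
      dif_pos rfl
    rw [h, tensorComplex_d]
    -- The tensor power and its differential unfold to the tensor product of the constant family.
    rfl

theorem tPowAct_mem {M : ChainComplex (ModuleCat.{u} Q) ℕ} {n : ℕ} (σ : Equiv.Perm (Fin k))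
    {y : TPow k M} (hy : y ∈ tPowDeg k M n) : tPowAct k M σ y ∈ tPowDeg k M n := by
  refine (Submodule.span_le (p := (tPowDeg k M n).comap (tPowAct k M σ))).2 ?_ hy
  rintro _ ⟨a, ha, x, rfl⟩
  rw [SetLike.mem_coe, Submodule.mem_comap, tPowAct_homTensor]
  refine Submodule.smul_mem _ _ (Submodule.subset_span ⟨_, ?_, _, rfl⟩)
  exact (Equiv.sum_comp σ.symm a).trans ha

theorem antisymmetrize_mem_extDeg (c : Q) {M : ChainComplex (ModuleCat.{u} Q) ℕ} {n : ℕ}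
    {y : TPow k M} (hy : y ∈ tPowDeg k M n) :
    antisymmetrize c (tPowRep k M) y ∈ extDeg k M n := by
  refine ⟨?_, antisymmetrize_mem _ _ _⟩
  rw [antisymmetrize_apply]
  exact Submodule.smul_mem _ _ (Submodule.sum_mem _ fun σ _ =>
    Submodule.smul_mem _ _ (tPowAct_mem k σ hy))

/-- The projection of the tensor power of a complex to the exterior power. -/
def extProj (c : Q) (M : ChainComplex (ModuleCat.{u} Q) ℕ) :
    (tensorComplex fun _ : Fin k => M) ⟶ extPowerObj k M where
  f n := ModuleCat.ofHom ((antisymmetrize c (tPowRep k M)).restrict (p := tPowDeg k M n)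
    (q := extDeg k M n) fun _ hy => antisymmetrize_mem_extDeg k c hy)
  comm' i j hij := by
    obtain rfl : j + 1 = i := hij
    have h : (extPowerObj k M).d (j + 1) j = ModuleCat.ofHom ((tPowD k M).restrict
        (p := extDeg k M (j + 1)) (q := extDeg k M j) fun _ hy => tPowD_mem_extDeg M hy) :=
      dif_pos rfl
    rw [h, tensorComplex_d]
    refine ModuleCat.hom_ext (LinearMap.ext fun y => Subtype.ext ?_)
    exact map_antisymmetrize c (tPowD k M)
      (fun σ y => (LinearMap.congr_fun (tPowAct_comp_tPowD M σ) y).symm) (Subtype.val y)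

theorem extInclusion_extProj {c : Q} (hc : c * ((k.factorial : ℕ) : Q) = 1)
    (M : ChainComplex (ModuleCat.{u} Q) ℕ) : extInclusion k M ≫ extProj k c M = 𝟙 _ := by
  ext n : 1
  refine ModuleCat.hom_ext (LinearMap.ext fun y => Subtype.ext ?_)
  exact antisymmetrize_of_mem c (tPowRep k M) hc (Subtype.property y).2

/-- The inclusion of the exterior power of a simplicial module in the tensor power. -/
def simplicialInclusion (A : SimplicialObject (ModuleCat.{u} Q)) :
    (extPowerSimplicial Q k).obj A ⟶ tensorSimplicial fun _ : Fin k => A where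
  app Δ := ModuleCat.ofHom (signPart (permRep Q k (A.obj Δ))).subtype
  naturality _ _ _ := rfl

/-- The projection of the tensor power of a simplicial module to the exterior power. -/
def simplicialProj (c : Q) (A : SimplicialObject (ModuleCat.{u} Q)) :
    (tensorSimplicial fun _ : Fin k => A) ⟶ (extPowerSimplicial Q k).obj A where
  app Δ := ModuleCat.ofHom ((antisymmetrize c (permRep Q k (A.obj Δ))).codRestrict _
    fun y => antisymmetrize_mem _ _ y)
  naturality Δ Δ' θ := by
    refine ModuleCat.hom_ext (LinearMap.ext fun y => Subtype.ext ?_)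
    refine (map_antisymmetrize c (PiTensorProduct.map fun _ : Fin k => (A.map θ).hom)
      (fun σ z => ?_) y).symm
    exact PiTensorProduct.map_reindex (R := Q) (fun _ : Fin k => (A.map θ).hom) σ z

theorem simplicialInclusion_simplicialProj {c : Q} (hc : c * ((k.factorial : ℕ) : Q) = 1)
    (A : SimplicialObject (ModuleCat.{u} Q)) :
    simplicialInclusion k A ≫ simplicialProj k c A = 𝟙 _ :=
  SimplicialObject.hom_ext _ _ fun Δ => ModuleCat.hom_ext (LinearMap.ext fun y => Subtype.ext
    (antisymmetrize_of_mem c (permRep Q k (A.obj Δ)) hc (Subtype.property y)))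

variable {M : ChainComplex (ModuleCat.{u} Q) ℕ} {A : SimplicialObject (ModuleCat.{u} Q)}
  (f : M ⟶ K[A])

/-- The shuffle map on the tensor power of `M`, in degree `n`. -/
def powShuffleLin (n : ℕ) : TPow k M →ₗ[Q] ⨂[Q] _ : Fin k, A.obj (op ⦋n⦌) :=
  shuffleLin (fun _ => A) n ∘ₗ tPowMap k f

theorem powShuffleLin_act (n : ℕ) (σ : Equiv.Perm (Fin k)) (y : TPow k M) :
    powShuffleLin k f n (tPowRep k M σ y) =
      permRep Q k (A.obj (op ⦋n⦌)) σ (powShuffleLin k f n y) := by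
  refine (congrArg (shuffleLin (fun _ : Fin k => A) n)
    (LinearMap.congr_fun (tPowMap_comp_tPowAct f σ) y)).trans ?_
  exact (LinearMap.congr_fun (permRep_comp_shuffleLin A n σ) (tPowMap k f y)).symm

theorem powShuffleLin_mem {n : ℕ} {y : TPow k M} (hy : y ∈ extDeg k M n) :
    powShuffleLin k f n y ∈ signPart (permRep Q k (A.obj (op ⦋n⦌))) := fun σ => by
  rw [← powShuffleLin_act, hy.2 σ, map_smul]

/-- The shuffle map from the tensor power. -/
def powShuffle : (tensorComplex fun _ : Fin k => M) ⟶ K[tensorSimplicial fun _ : Fin k => A] :=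
  tensorMap (fun _ => f) ≫ shuffle fun _ => A

theorem powShuffle_f_apply (n : ℕ) (y : tPowDeg k M n) :
    ((powShuffle k f).f n).hom y = powShuffleLin k f n y := by
  change shuffleLin (fun _ => A) n (PiTensorProduct.map (fun _ : Fin k =>
    gradedMap 0 fun n => (f.f n).hom) (Subtype.val y)) = _
  rw [map_gradedMap_eq_totMap]
  rfl

/-- The shuffle map on exterior powers, in degree `n`. -/
def extShuffleX (n : ℕ) : (extPowerObj k M).X n ⟶ (K[(extPowerSimplicial Q k).obj A]).X n :=
  ModuleCat.ofHom ((powShuffleLin k f n).restrict (p := extDeg k M n)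
    (q := signPart (permRep Q k (A.obj (op ⦋n⦌)))) fun _ hy => powShuffleLin_mem k f hy)

theorem extShuffleX_comp (n : ℕ) :
    extShuffleX k f n ≫ (AlternatingFaceMapComplex.map (simplicialInclusion k A)).f n =
      (extInclusion k M).f n ≫ (powShuffle k f).f n :=
  ModuleCat.hom_ext (LinearMap.ext fun y =>
    (powShuffle_f_apply k f n ⟨Subtype.val y, (Subtype.property y).1⟩).symm)

instance mono_map_simplicialInclusion_f (A : SimplicialObject (ModuleCat.{u} Q)) (n : ℕ) :
    Mono ((AlternatingFaceMapComplex.map (simplicialInclusion k A)).f n) :=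
  (ModuleCat.mono_iff_injective _).2 Subtype.val_injective

/-- The shuffle map on exterior powers. -/
def extShuffle : extPowerObj k M ⟶ K[(extPowerSimplicial Q k).obj A] where
  f n := extShuffleX k f n
  comm' i j _ := by
    -- Compatibility with differentials is tested after the inclusion into the tensor power, where
    -- it follows from `powShuffle` being a chain map.
    rw [← cancel_mono ((AlternatingFaceMapComplex.map (simplicialInclusion k A)).f j),
      Category.assoc, Category.assoc, extShuffleX_comp, ← HomologicalComplex.Hom.comm,
      ← Category.assoc, extShuffleX_comp, Category.assoc, HomologicalComplex.Hom.comm,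
      ← Category.assoc, ← Category.assoc, HomologicalComplex.Hom.comm]

theorem extShuffle_comp : extShuffle k f ≫
    AlternatingFaceMapComplex.map (simplicialInclusion k A) =
      extInclusion k M ≫ powShuffle k f := by
  ext n : 1
  exact extShuffleX_comp k f n

theorem extProj_comp (c : Q) : extProj k c M ≫ extShuffle k f =
    powShuffle k f ≫ AlternatingFaceMapComplex.map (simplicialProj k c A) := by
  ext n : 1
  refine ModuleCat.hom_ext (LinearMap.ext fun y => Subtype.ext ?_)
  refine (map_antisymmetrize c (powShuffleLin k f n) (powShuffleLin_act k f n)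
    (Subtype.val y)).trans ?_
  exact congrArg (antisymmetrize c (permRep Q k (A.obj (op ⦋n⦌))))
    (powShuffle_f_apply k f n y).symm

/-- The shuffle map on exterior powers is a retract of the shuffle map on tensor powers. -/
def extShuffleRetract {c : Q} (hc : c * ((k.factorial : ℕ) : Q) = 1) :
    RetractArrow (extShuffle k f) (powShuffle k f) where
  i := Arrow.homMk (extInclusion k M) (AlternatingFaceMapComplex.map (simplicialInclusion k A))
    (extShuffle_comp k f).symm
  r := Arrow.homMk (extProj k c M) (AlternatingFaceMapComplex.map (simplicialProj k c A))
    (extProj_comp k f c)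
  retract := Arrow.hom_ext _ _ (extInclusion_extProj k hc M)
    (((alternatingFaceMapComplex _).map_comp _ _).symm.trans
      ((congrArg (alternatingFaceMapComplex _).map
        (simplicialInclusion_simplicialProj k hc A)).trans
        ((alternatingFaceMapComplex _).map_id _)))

/-- The inverse `c` of `k!` makes the sign parts retracts, and retracts of quasi-isomorphisms are
quasi-isomorphisms. Invertibility is needed only here; the map and its naturality do not involve it.
-/
theorem quasiIso_extShuffle (hk : IsUnit ((k.factorial : ℕ) : Q)) (e : HomotopyEquiv M (K[A])) :
    QuasiIso (extShuffle k e.hom) := by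
  obtain ⟨c, hc⟩ := hk.exists_left_inv
  have h1 : QuasiIso (tensorMap fun _ : Fin k => e.hom) := quasiIso_tensorMap fun _ => e
  have h2 := quasiIso_shuffle fun _ : Fin k => A
  have h3 : QuasiIso (powShuffle k e.hom) := by
    unfold powShuffle
    infer_instance
  exact quasiIso_of_retractArrow (extShuffleRetract k e.hom hc)

theorem extShuffle_naturality {M' : ChainComplex (ModuleCat.{u} Q) ℕ}
    {A' : SimplicialObject (ModuleCat.{u} Q)} (f' : M' ⟶ K[A']) (a : M ⟶ M') (b : A ⟶ A')
    (h : f ≫ AlternatingFaceMapComplex.map b = a ≫ f') :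
    (extPowerComplex Q k).map a ≫ extShuffle k f' =
      extShuffle k f ≫ AlternatingFaceMapComplex.map ((extPowerSimplicial Q k).map b) := by
  ext n : 1
  refine ModuleCat.hom_ext (LinearMap.ext fun y => Subtype.ext ?_)
  have e : powShuffleLin k f' n ∘ₗ tPowMap k a =
      (PiTensorProduct.map fun _ : Fin k => (b.app (op ⦋n⦌)).hom) ∘ₗ powShuffleLin k f n := by
    rw [powShuffleLin, powShuffleLin, ← LinearMap.comp_assoc,
      shuffleLin_naturality (fun _ : Fin k => b), LinearMap.comp_assoc, LinearMap.comp_assoc]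
    congr 1
    rw [tPowMap, tPowMap, tPowMap, ← PiTensorProduct.map_comp, ← PiTensorProduct.map_comp]
    simp only [← totMap_comp, h]
  exact LinearMap.congr_fun e (Subtype.val y)

end Retract

/-! ### The comparison map -/

section Comparison

/-- The homotopy equivalence of a complex `M` and the alternating face map complex of the
simplicial module that corresponds to `M`. -/
def doldKanUnit (M : ChainComplex (ModuleCat.{u} Q) ℕ) :
    HomotopyEquiv M (K[Abelian.DoldKan.Γ.obj M]) :=
  (HomotopyEquiv.ofIso (Abelian.DoldKan.equivalence.counitIso.app M).symm).trans
    (DoldKan.homotopyEquivNormalizedMooreComplexAlternatingFaceMapComplex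
      (Y := Abelian.DoldKan.Γ.obj M))

/-- The forward map is the inverse Dold–Kan counit followed by the inclusion of the Moore complex,
and both are natural. -/
theorem doldKanUnit_naturality {M M' : ChainComplex (ModuleCat.{u} Q) ℕ} (a : M ⟶ M') :
    (doldKanUnit M).hom ≫ AlternatingFaceMapComplex.map (Abelian.DoldKan.Γ.map a) =
      a ≫ (doldKanUnit M').hom := by
  have h1 := Abelian.DoldKan.equivalence.counitIso.inv.naturality a
  have h2 := (inclusionOfMooreComplex (ModuleCat.{u} Q)).naturality (Abelian.DoldKan.Γ.map a)
  change (_ ≫ (inclusionOfMooreComplex (ModuleCat.{u} Q)).app _) ≫ _ =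
    a ≫ _ ≫ (inclusionOfMooreComplex (ModuleCat.{u} Q)).app _
  refine (Category.assoc _ _ _).trans ((congrArg _ h2.symm).trans ?_)
  refine (Category.assoc _ _ _).symm.trans (Eq.trans ?_ (Category.assoc _ _ _))
  exact congrArg (fun t => t ≫ (inclusionOfMooreComplex (ModuleCat.{u} Q)).app _) h1.symm

/-- The comparison map from the exterior power of a complex to the Dold-Puppe exterior power. -/
def comparison (Q : Type u) [CommRing Q] (k : ℕ) : extPowerComplex Q k ⟶ doldPuppeExtPower Q k where
  app M := extShuffle k (doldKanUnit M).hom ≫ DoldKan.PInftyToNormalizedMooreComplex _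
  naturality M M' a := by
    have h1 := extShuffle_naturality k _ _ a _ (doldKanUnit_naturality a)
    have h2 := DoldKan.PInftyToNormalizedMooreComplex_naturality
      ((extPowerSimplicial Q k).map (Abelian.DoldKan.Γ.map a))
    refine (Category.assoc _ _ _).symm.trans ?_
    refine (congrArg (fun t => t ≫ DoldKan.PInftyToNormalizedMooreComplex _) h1).trans ?_
    exact (Category.assoc _ _ _).trans ((congrArg _ h2).trans (Category.assoc _ _ _).symm)

end Comparison

end

end NaiveExteriorPower

end

theorem mainTheorem7 {Q : Type u} [CommRing Q] (k : ℕ) (hk : 1 ≤ k)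
    (hQ : IsUnit ((k.factorial : ℕ) : Q)) :
    ∃ φ : NaiveExteriorPower.extPowerComplex Q k ⟶ NaiveExteriorPower.doldPuppeExtPower Q k,
      ∀ M : ChainComplex (ModuleCat.{u} Q) ℕ, QuasiIso (φ.app M) := by
  refine ⟨NaiveExteriorPower.comparison Q k, fun M => ?_⟩
  have h1 := NaiveExteriorPower.quasiIso_extShuffle k hQ (NaiveExteriorPower.doldKanUnit M)
  exact quasiIso_comp (hφ := h1)
    (hφ' := NaiveExteriorPower.quasiIso_PInftyToNormalizedMooreComplex _)
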